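/- \textbf{Setting.} Let $(V,E)$ be a finite multigraph with source and target maps $s,t:E\to V$ and without isolated vertices (every vertex is the source or the target of some edge). For $i,j\in V$ let $E^i_j$ be the set of edges from $i$ to $j$, and let $N=\max_{i,j}|E^i_j|$ and $X_N=\{1,\dots,N\}$. Assume that $(V,E)$ is uniform, that is, all nonempty sets $E^i_j$ have the same number of elements. Fix an edge-labeling, that is, a numbering of each $E^i_j$ by $1,\dots,|E^i_j|$; write $(i,j)r$ for the edge from $i$ to $j$ with label $r$. All tensor products of C*-algebras are minimal. A compact quantum group (CQG) is a pair $(\mathcal A,\Delta)$ of a nonzero unital C*-algebra and a coassociative unital $*$-homomorphism $\Delta:\mathcal A\to\mathcal A\otimes\mathcal A$ for which $\Delta(\mathcal A)(1\otimes\mathcal A)$ and $\Delta(\mathcal A)(\mathcal A\otimes 1)$ span dense subspaces of $\mathcal A\otimes\mathcal A$. A co-action of $(\mathcal A,\Delta)$ on a finite-dimensional commutative C*-algebra $B$ is a unital $*$-homomorphism $\alpha:B\to B\otimes\mathcal A$ such that $(\alpha\otimes\mathrm{id})\alpha=(\mathrm{id}\otimes\Delta)\alpha$ and $\alpha(B)(1\otimes\mathcal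 A)$ spans a dense subspace of $B\otimes\mathcal A$. Let $\mathcal C_{(V,E)}$ be the category whose objects are the triples $(\mathcal A,\Delta,\alpha)$, where $\alpha$ is a co-action of a CQG $(\mathcal A,\Delta)$ on $C(V)\otimes C(X_N)$ such that (a) $\alpha(C(V)\otimes 1)\subseteq C(V)\otimes 1\otimes\mathcal A$, and (b) $Ad_\alpha(\mathcal E)\subseteq\mathcal E\otimes\mathcal A$, where $\mathcal E=\mathrm{span}\{e_{ij}\otimes f_{rr}: E^i_j\neq\emptyset,\ 1\le r\le|E^i_j|\}\subseteq B(L^2(V))\otimes B(L^2(X_N))$, with $e_{ij}$ and $f_{rs}$ the matrix units. Here $Ad_\alpha(T)=U(T\otimes 1)U^*$, with $U=(u^{ks}_{ir})$ the matrix over $\mathcal A$ given by $\alpha(\chi_i\otimes\chi_r)=\sum_{k,s}\chi_k\otimes\chi_s\otimes u^{ks}_{ir}$. A morphism $(\mathcal A,\Delta,\alpha)\to(\mathcal A',\Delta',\alpha')$ is a unital $*$-homomorphism $f:\mathcal A\to\mathcal A'$ with $(f\otimes f)\Delta=\Delta' f$ and $(\mathrm{id}\otimes f)\alpha=\alpha'$.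 \textbf{Theorem.} The category $\mathcal C_{(V,E)}$ has a universal object $(Q_{(V,E)},\Delta,\alpha)$: for every object of $\mathcal C_{(V,E)}$ there is exactly one morphism from $(Q_{(V,E)},\Delta,\alpha)$ to it. The algebra $Q_{(V,E)}$ is the universal C*-algebra generated by elements $q^{ks}_{ir}$ ($k,i\in V$; $s,r=1,\dots,N$) subject to the following relations: (1) quantum permutation relations: every $q^{ks}_{ir}$ is a self-adjoint idempotent, $\sum_{i,r}q^{ks}_{ir}=1$ for all $k,s$, and $\sum_{k,s}q^{ks}_{ir}=1$ for all $i,r$; (2) $\sum_{r=1}^N q^{ks}_{ir}=\sum_{r=1}^N q^{ks'}_{ir}$ for all $k,i\in V$ and all $s,s'$; (3) $q^{ks}_{ir}q^{ls'}_{jr}=0$ whenever $(i,j)r\in E$ and $E^k_l=\emptyset$; (4) $q^{ks}_{ir}q^{ls'}_{jr}=0$ whenever $(i,j)r\in E$, $E^k_l\neq\emptyset$ and $s\neq s'$. The co-product is given by $\Delta(q^{ks}_{ir})=\sum_{k'\in V}\sum_{s'=1}^N q^{ks}_{k's'}\otimes q^{k's'}_{ir}$, and the canonical co-action on $C(V)\otimes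 C(X_N)$ by $\alpha(\chi_i\otimes\chi_r)=\sum_{k\in V}\sum_{s=1}^N\chi_k\otimes\chi_s\otimes q^{ks}_{ir}$. -/

import Mathlib

open scoped TensorProduct ENNReal

universe u v w

noncomputable section

/-! ### The Hilbert space tensor product -/

section HilbertTensor

variable {H K L : Type u}
  [NormedAddCommGroup H] [InnerProductSpace ℂ H]
  [NormedAddCommGroup K] [InnerProductSpace ℂ K]
  [NormedAddCommGroup L] [InnerProductSpace ℂ L]

variable (H K) in
/-- The Hilbert space tensor product: the completion of the algebraic tensor product for the inner
product `⟪ξ ⊗ η, ξ' ⊗ η'⟫ = ⟪ξ, ξ'⟫ * ⟪η, η'⟫`. -/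
def HilbertTensor : Type u := UniformSpace.Completion (H ⊗[ℂ] K)

instance HilbertTensor.instNormedAddCommGroup : NormedAddCommGroup (HilbertTensor H K) :=
  inferInstanceAs (NormedAddCommGroup (UniformSpace.Completion (H ⊗[ℂ] K)))

instance HilbertTensor.instInnerProductSpace : InnerProductSpace ℂ (HilbertTensor H K) :=
  inferInstanceAs (InnerProductSpace ℂ (UniformSpace.Completion (H ⊗[ℂ] K)))

instance HilbertTensor.instCompleteSpace : CompleteSpace (HilbertTensor H K) :=
  inferInstanceAs (CompleteSpace (UniformSpace.Completion (H ⊗[ℂ] K)))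

variable (H K) in
/-- The isometric inclusion of the algebraic tensor product. -/
def HilbertTensor.incl : H ⊗[ℂ] K →ₗᵢ[ℂ] HilbertTensor H K :=
  (UniformSpace.Completion.toComplₗᵢ : H ⊗[ℂ] K →ₗᵢ[ℂ] UniformSpace.Completion (H ⊗[ℂ] K))

theorem HilbertTensor.denseRange_incl : DenseRange (HilbertTensor.incl H K) :=
  UniformSpace.Completion.denseRange_coe

@[elab_as_elim]
theorem HilbertTensor.induction_on {p : HilbertTensor H K → Prop} (x : HilbertTensor H K)
    (hp : IsClosed {x | p x}) (ih : ∀ z : H ⊗[ℂ] K, p (HilbertTensor.incl H K z)) : p x :=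
  HilbertTensor.denseRange_incl.induction_on x hp ih

/-- The continuous extension of a bounded operator to the completion. -/
def HilbertTensor.extend {M : Type u} [NormedAddCommGroup M] [InnerProductSpace ℂ M]
    [CompleteSpace M] (f : H ⊗[ℂ] K →L[ℂ] M) : HilbertTensor H K →L[ℂ] M :=
  f.extend (HilbertTensor.incl H K).toContinuousLinearMap

theorem HilbertTensor.extend_incl {M : Type u} [NormedAddCommGroup M] [InnerProductSpace ℂ M]
    [CompleteSpace M] (f : H ⊗[ℂ] K →L[ℂ] M) (z : H ⊗[ℂ] K) :
    HilbertTensor.extend f (HilbertTensor.incl H K z) = f z :=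
  f.extend_eq HilbertTensor.denseRange_incl
    (HilbertTensor.incl H K).isometry.isUniformInducing z

/-- The elementary tensor `ξ ⊗ η`. -/
def HilbertTensor.tmul (ξ : H) (η : K) : HilbertTensor H K := HilbertTensor.incl H K (ξ ⊗ₜ[ℂ] η)

instance HilbertTensor.instNontrivial [Nontrivial H] [Nontrivial K] :
    Nontrivial (HilbertTensor H K) := by
  obtain ⟨ξ, hξ⟩ := exists_ne (0 : H)
  obtain ⟨η, hη⟩ := exists_ne (0 : K)
  refine ⟨HilbertTensor.tmul ξ η, 0, fun h => ?_⟩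
  have h1 : ‖HilbertTensor.tmul ξ η‖ = ‖ξ‖ * ‖η‖ := by
    rw [HilbertTensor.tmul, LinearIsometry.norm_map, TensorProduct.norm_tmul]
  rw [h, norm_zero] at h1
  exact (mul_pos (norm_pos_iff.2 hξ) (norm_pos_iff.2 hη)).ne h1

/-- The bounded operator `S ⊗ T` on the Hilbert space tensor product. -/
def opTensor (S : H →L[ℂ] H) (T : K →L[ℂ] K) : HilbertTensor H K →L[ℂ] HilbertTensor H K :=
  HilbertTensor.extend
    ((HilbertTensor.incl H K).toContinuousLinearMap.comp (TensorProduct.mapL S T))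

theorem opTensor_incl (S : H →L[ℂ] H) (T : K →L[ℂ] K) (z : H ⊗[ℂ] K) :
    opTensor S T (HilbertTensor.incl H K z) =
      HilbertTensor.incl H K (TensorProduct.mapL S T z) := by
  rw [opTensor, HilbertTensor.extend_incl]
  rfl

theorem opTensor_tmul (S : H →L[ℂ] H) (T : K →L[ℂ] K) (ξ : H) (η : K) :
    opTensor S T (HilbertTensor.tmul ξ η) = HilbertTensor.tmul (S ξ) (T η) := by
  rw [HilbertTensor.tmul, opTensor_incl, TensorProduct.mapL_tmul, HilbertTensor.tmul]

theorem norm_opTensor_le (S : H →L[ℂ] H) (T : K →L[ℂ] K) : ‖opTensor S T‖ ≤ ‖S‖ * ‖T‖ := by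
  refine ContinuousLinearMap.opNorm_le_bound _ (by positivity) fun x => ?_
  induction x using HilbertTensor.induction_on with
  | hp => apply isClosed_le <;> fun_prop
  | ih x =>
    rw [opTensor_incl, LinearIsometry.norm_map, LinearIsometry.norm_map]
    exact (ContinuousLinearMap.le_opNorm _ x).trans
      (mul_le_mul_of_nonneg_right (TensorProduct.norm_mapL_le S T) (norm_nonneg x))

/-- For `ζ` in `L`, the operator `H ⊗ K → H ⊗ (K ⊗ L)`, `ξ ⊗ η ↦ ξ ⊗ (η ⊗ ζ)`. -/
def hilbertInsert (ζ : L) : HilbertTensor H K →L[ℂ] HilbertTensor H (HilbertTensor K L) :=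
  HilbertTensor.extend ((HilbertTensor.incl H (HilbertTensor K L)).toContinuousLinearMap.comp
    (TensorProduct.mapL (ContinuousLinearMap.id ℂ H)
      ((HilbertTensor.incl K L).toContinuousLinearMap.comp ((TensorProduct.mkL ℂ K L).flip ζ))))

theorem hilbertInsert_tmul (ξ : H) (η : K) (ζ : L) :
    hilbertInsert ζ (HilbertTensor.incl H K (ξ ⊗ₜ η)) =
      HilbertTensor.incl H (HilbertTensor K L) (ξ ⊗ₜ HilbertTensor.incl K L (η ⊗ₜ ζ)) := by
  rw [hilbertInsert, HilbertTensor.extend_incl]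
  simp

theorem inner_hilbertInsert (ζ ζ' : L) (x y : HilbertTensor H K) :
    inner ℂ (hilbertInsert ζ x) (hilbertInsert ζ' y) = inner ℂ x y * inner ℂ ζ ζ' := by
  induction x using HilbertTensor.induction_on with
  | hp => apply isClosed_eq <;> fun_prop
  | ih x =>
    induction y using HilbertTensor.induction_on with
    | hp => apply isClosed_eq <;> fun_prop
    | ih y =>
      induction x using TensorProduct.induction_on with
      | zero => simp
      | add a b ha hb => simp only [map_add, inner_add_left, ha, hb, add_mul]
      | tmul ξ η =>
        induction y using TensorProduct.induction_on with
        | zero => simp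
        | add a b ha hb => simp only [map_add, inner_add_right, ha, hb, add_mul]
        | tmul ξ' η' =>
          rw [hilbertInsert_tmul, hilbertInsert_tmul]
          simp only [LinearIsometry.inner_map_map, TensorProduct.inner_tmul, mul_assoc]

theorem hilbertInsert_add (ζ ζ' : L) (x : HilbertTensor H K) :
    hilbertInsert (ζ + ζ') x = hilbertInsert ζ x + hilbertInsert ζ' x := by
  induction x using HilbertTensor.induction_on with
  | hp => apply isClosed_eq <;> fun_prop
  | ih x =>
    induction x using TensorProduct.induction_on with
    | zero => simp
    | add a b ha hb => rw [map_add, map_add, map_add, map_add, ha, hb]; abel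
    | tmul ξ η => simp only [hilbertInsert_tmul, TensorProduct.tmul_add, map_add]

theorem hilbertInsert_smul (c : ℂ) (ζ : L) (x : HilbertTensor H K) :
    hilbertInsert (c • ζ) x = c • hilbertInsert ζ x := by
  induction x using HilbertTensor.induction_on with
  | hp =>
    exact isClosed_eq (hilbertInsert _).continuous ((hilbertInsert _).continuous.const_smul c)
  | ih x =>
    induction x using TensorProduct.induction_on with
    | zero => simp
    | add a b ha hb => rw [map_add, map_add, map_add, ha, hb, smul_add]
    | tmul ξ η => simp only [hilbertInsert_tmul, TensorProduct.tmul_smul, map_smul]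

variable (H K L) in
/-- The associator on the dense subspace `(H ⊗ K) ⊗ L`. -/
def hilbertAssocAux :
    (HilbertTensor H K) ⊗[ℂ] L →ₗᵢ[ℂ] HilbertTensor H (HilbertTensor K L) :=
  (TensorProduct.lift (LinearMap.mk₂ ℂ (fun (x : HilbertTensor H K) (ζ : L) => hilbertInsert ζ x)
    (fun x y ζ => map_add _ x y) (fun c x ζ => map_smul _ c x)
    (fun x ζ ζ' => hilbertInsert_add ζ ζ' x)
    (fun c x ζ => hilbertInsert_smul c ζ x))).isometryOfInner (by
      intro z w
      induction z using TensorProduct.induction_on with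
      | zero => simp
      | add a b ha hb => rw [map_add, inner_add_left, inner_add_left, ha, hb]
      | tmul x ζ =>
        induction w using TensorProduct.induction_on with
        | zero => simp
        | add a b ha hb => rw [map_add, inner_add_right, inner_add_right, ha, hb]
        | tmul y ζ' => simp [inner_hilbertInsert])

variable (H K L) in
/-- The canonical unitary `(H ⊗ K) ⊗ L → H ⊗ (K ⊗ L)`, `(ξ ⊗ η) ⊗ ζ ↦ ξ ⊗ (η ⊗ ζ)`. -/
def hilbertAssoc :
    HilbertTensor (HilbertTensor H K) L →L[ℂ] HilbertTensor H (HilbertTensor K L) :=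
  HilbertTensor.extend (hilbertAssocAux H K L).toContinuousLinearMap

theorem hilbertAssoc_tmul (ξ : H) (η : K) (ζ : L) :
    hilbertAssoc H K L (HilbertTensor.tmul (HilbertTensor.tmul ξ η) ζ) =
      HilbertTensor.tmul ξ (HilbertTensor.tmul η ζ) := by
  rw [hilbertAssoc, HilbertTensor.tmul, HilbertTensor.extend_incl]
  exact hilbertInsert_tmul ξ η ζ

theorem norm_hilbertAssoc (x : HilbertTensor (HilbertTensor H K) L) :
    ‖hilbertAssoc H K L x‖ = ‖x‖ := by
  induction x using HilbertTensor.induction_on with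
  | hp => apply isClosed_eq <;> fun_prop
  | ih x =>
    rw [hilbertAssoc, HilbertTensor.extend_incl, LinearIsometry.norm_map]
    exact LinearIsometry.norm_map _ x

end HilbertTensor

/-! ### Representations and the minimal tensor product of C*-algebras -/

/-- A unital `*`-representation of a unital C*-algebra on a nonzero Hilbert space. -/
structure HilbertRep (A : Type u) [CStarAlgebra A] : Type (u + 1) where
  space : Type u
  [normedAddCommGroup : NormedAddCommGroup space]
  [innerProductSpace : InnerProductSpace ℂ space]
  [completeSpace : CompleteSpace space]
  [nontrivial : Nontrivial space]
  hom : A →⋆ₐ[ℂ] (space →L[ℂ] space)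

attribute [instance] HilbertRep.normedAddCommGroup HilbertRep.innerProductSpace
  HilbertRep.completeSpace HilbertRep.nontrivial

/-- Restriction of a representation along a unital `*`-homomorphism. -/
def HilbertRep.comp {A B : Type u} [CStarAlgebra A] [CStarAlgebra B]
    (π : HilbertRep B) (f : A →⋆ₐ[ℂ] B) : HilbertRep A where
  space := π.space
  hom := π.hom.comp f

section MinTensor

variable (A B : Type u) [CStarAlgebra A] [CStarAlgebra B]

/-- The bounded families of operators on the Hilbert spaces `H_π ⊗ H_ρ`, indexed by all pairs of
representations `π` of `A` and `ρ` of `B`, with the supremum norm. -/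
abbrev RepFamily : Type (u + 1) :=
  lp (fun p : HilbertRep A × HilbertRep B =>
    HilbertTensor p.1.space p.2.space →L[ℂ] HilbertTensor p.1.space p.2.space) ∞

instance RepFamily.instCStarAlgebra : CStarAlgebra (RepFamily A B) where

variable {A B} in
/-- The family `(π(a) ⊗ ρ(b))` over all pairs `(π, ρ)`. -/
def repTensor (a : A) (b : B) : RepFamily A B :=
  ⟨fun p => opTensor (p.1.hom a) (p.2.hom b), by
    refine memℓp_infty ⟨‖a‖ * ‖b‖, ?_⟩
    rintro _ ⟨p, rfl⟩
    exact (norm_opTensor_le _ _).trans (mul_le_mul (NonUnitalStarAlgHom.norm_apply_le p.1.hom a)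
      (NonUnitalStarAlgHom.norm_apply_le p.2.hom b) (norm_nonneg _) (norm_nonneg _))⟩

/-- The minimal (spatial) tensor product as a closed `*`-subalgebra: the closed linear span of the
families `(π(a) ⊗ ρ(b))`. Its norm on the algebraic tensor product is the spatial norm
`‖x‖ = sup ‖(π ⊗ ρ)(x)‖` over all pairs of representations. -/
def minTensorSubalgebra : StarSubalgebra ℂ (RepFamily A B) :=
  (StarAlgebra.adjoin ℂ {x | ∃ (a : A) (b : B), x = repTensor a b}).topologicalClosure

/-- The minimal (spatial) tensor product of two unital C*-algebras. -/
def MinTensor : Type (u + 1) := minTensorSubalgebra A B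

instance minTensorSubalgebra.instIsClosed :
    IsClosed (minTensorSubalgebra A B : Set (RepFamily A B)) :=
  StarSubalgebra.isClosed_topologicalClosure _

instance MinTensor.instCStarAlgebra : CStarAlgebra (MinTensor A B) :=
  inferInstanceAs (CStarAlgebra (minTensorSubalgebra A B))

variable {A B}

/-- The elementary tensor `a ⊗ b` in the minimal tensor product. -/
def MinTensor.tmul (a : A) (b : B) : MinTensor A B :=
  ⟨repTensor a b, StarSubalgebra.le_topologicalClosure _
    (StarAlgebra.subset_adjoin ℂ _ ⟨a, b, rfl⟩)⟩

/-- The representation `π ⊗ ρ` of the minimal tensor product on the Hilbert space `H_π ⊗ H_ρ`. -/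
def MinTensor.eval (π : HilbertRep A) (ρ : HilbertRep B) :
    MinTensor A B →⋆ₐ[ℂ]
      (HilbertTensor π.space ρ.space →L[ℂ] HilbertTensor π.space ρ.space) where
  toFun x := x.1 (π, ρ)
  map_one' := rfl
  map_mul' _ _ := rfl
  map_zero' := rfl
  map_add' _ _ := rfl
  commutes' _ := rfl
  map_star' _ := rfl

theorem MinTensor.eval_tmul (π : HilbertRep A) (ρ : HilbertRep B) (a : A) (b : B) :
    MinTensor.eval π ρ (MinTensor.tmul a b) = opTensor (π.hom a) (ρ.hom b) := rfl

end MinTensor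

section MinTensorMap

variable {A B C D : Type u} [CStarAlgebra A] [CStarAlgebra B] [CStarAlgebra C] [CStarAlgebra D]

/-- Pulling back a family along `(π, ρ) ↦ (π ∘ f, ρ ∘ g)`. -/
def RepFamily.reindex (f : A →⋆ₐ[ℂ] C) (g : B →⋆ₐ[ℂ] D) : RepFamily A B →⋆ₐ[ℂ] RepFamily C D where
  toFun x := ⟨fun p => x.1 (p.1.comp f, p.2.comp g), by
    refine memℓp_infty ⟨‖x‖, ?_⟩
    rintro _ ⟨p, rfl⟩
    exact lp.norm_apply_le_norm ENNReal.top_ne_zero x (p.1.comp f, p.2.comp g)⟩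
  map_one' := rfl
  map_mul' _ _ := rfl
  map_zero' := rfl
  map_add' _ _ := rfl
  commutes' _ := rfl
  map_star' _ := rfl

theorem RepFamily.reindex_mem (f : A →⋆ₐ[ℂ] C) (g : B →⋆ₐ[ℂ] D) (x : RepFamily A B)
    (hx : x ∈ minTensorSubalgebra A B) : RepFamily.reindex f g x ∈ minTensorSubalgebra C D := by
  have hc : Continuous (RepFamily.reindex f g) := by
    refine AddMonoidHomClass.continuous_of_bound _ 1 fun y => ?_
    rw [one_mul]
    refine lp.norm_le_of_forall_le (norm_nonneg y) fun p => ?_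
    exact lp.norm_apply_le_norm ENNReal.top_ne_zero y (p.1.comp f, p.2.comp g)
  have h : StarAlgebra.adjoin ℂ {x | ∃ (a : A) (b : B), x = repTensor a b} ≤
      (minTensorSubalgebra C D).comap (RepFamily.reindex f g) := by
    refine StarAlgebra.adjoin_le ?_
    rintro _ ⟨a, b, rfl⟩
    exact (MinTensor.tmul (f a) (g b)).2
  have h2 := StarSubalgebra.topologicalClosure_minimal h
    ((minTensorSubalgebra.instIsClosed C D).preimage hc)
  exact h2 hx

/-- The `*`-homomorphism `f ⊗ g` between minimal tensor products. -/
def MinTensor.map (f : A →⋆ₐ[ℂ] C) (g : B →⋆ₐ[ℂ] D) : MinTensor A B →⋆ₐ[ℂ] MinTensor C D where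
  toFun x := ⟨RepFamily.reindex f g x.1, RepFamily.reindex_mem f g x.1 x.2⟩
  map_one' := rfl
  map_mul' _ _ := rfl
  map_zero' := rfl
  map_add' _ _ := rfl
  commutes' _ := rfl
  map_star' _ := rfl

theorem MinTensor.map_tmul (f : A →⋆ₐ[ℂ] C) (g : B →⋆ₐ[ℂ] D) (a : A) (b : B) :
    MinTensor.map f g (MinTensor.tmul a b) = MinTensor.tmul (f a) (g b) := rfl

end MinTensorMap

/-! ### Compact quantum groups -/

section Comultiplication

variable {A : Type u} [CStarAlgebra A] (Δ : A →⋆ₐ[ℂ] MinTensor A A)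

/-- The representation `(π ⊗ ρ) ∘ Δ` of `A`. -/
def HilbertRep.conv (π ρ : HilbertRep A) : HilbertRep A where
  space := HilbertTensor π.space ρ.space
  hom := (MinTensor.eval π ρ).comp Δ

/-- Coassociativity `(Δ ⊗ id)Δ = (id ⊗ Δ)Δ` in `A ⊗ A ⊗ A`. An element of the minimal tensor product
`A ⊗ A ⊗ A` is determined by its images under the representations `π₁ ⊗ π₂ ⊗ π₃`; under these,
`(Δ ⊗ id)(x)` is `((π₁ ⊗ π₂)Δ ⊗ π₃)(x)` acting on `(H₁ ⊗ H₂) ⊗ H₃`, and `(id ⊗ Δ)(x)` is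
`(π₁ ⊗ (π₂ ⊗ π₃)Δ)(x)` acting on `H₁ ⊗ (H₂ ⊗ H₃)`. The two Hilbert spaces are identified by the
associator. -/
def IsCoassociative : Prop :=
  ∀ (a : A) (π₁ π₂ π₃ : HilbertRep A),
    (hilbertAssoc π₁.space π₂.space π₃.space).comp
        (MinTensor.eval (HilbertRep.conv Δ π₁ π₂) π₃ (Δ a)) =
      (MinTensor.eval π₁ (HilbertRep.conv Δ π₂ π₃) (Δ a)).comp
        (hilbertAssoc π₁.space π₂.space π₃.space)

end Comultiplication

/-- A compact quantum group in the sense of Woronowicz: a nonzero unital C*-algebra `A` with a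
coassociative unital `*`-homomorphism `Δ : A → A ⊗ A` such that `Δ(A)(1 ⊗ A)` and `Δ(A)(A ⊗ 1)`
span dense subspaces of `A ⊗ A`. -/
structure CompactQuantumGroup : Type (u + 1) where
  carrier : Type u
  [cstarAlgebra : CStarAlgebra carrier]
  [nontrivial : Nontrivial carrier]
  comul : carrier →⋆ₐ[ℂ] MinTensor carrier carrier
  coassoc : IsCoassociative comul
  dense_right : Dense (Submodule.span ℂ
    {x | ∃ a b : carrier, x = comul a * MinTensor.tmul 1 b} : Set (MinTensor carrier carrier))
  dense_left : Dense (Submodule.span ℂ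
    {x | ∃ a b : carrier, x = comul a * MinTensor.tmul b 1} : Set (MinTensor carrier carrier))

attribute [instance] CompactQuantumGroup.cstarAlgebra CompactQuantumGroup.nontrivial

/-- `f` is a homomorphism of compact quantum groups: `(f ⊗ f) Δ = Δ f`. -/
def IsQuantumGroupHom (S T : CompactQuantumGroup.{u}) (f : S.carrier →⋆ₐ[ℂ] T.carrier) : Prop :=
  ∀ a, MinTensor.map f f (S.comul a) = T.comul (f a)

/-! ### Co-actions on the algebra of functions on a finite set

For a finite set `Y`, the algebra `C(Y)` is `Y → ℂ`, the tensor product `C(Y) ⊗ A` is `Y → A`, and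
`C(Y) ⊗ A ⊗ A` is `Y → A ⊗ A`. -/

section Coaction

variable {Y : Type v} [Fintype Y] [DecidableEq Y]

/-- The elementary tensor `f ⊗ a` in `C(Y) ⊗ A`. -/
def functionTensor {A : Type u} [CStarAlgebra A] (f : Y → ℂ) (a : A) : Y → A := fun y => f y • a

/-- The characteristic function of a point. -/
def pointFunction (y : Y) : Y → ℂ := Pi.single y 1

variable (S : CompactQuantumGroup.{u}) (α : (Y → ℂ) →⋆ₐ[ℂ] (Y → S.carrier))

/-- The map `α ⊗ id : C(Y) ⊗ A → C(Y) ⊗ A ⊗ A`; an element `F` of `C(Y) ⊗ A` is the sum of the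
`χ_y ⊗ F(y)`. -/
def coactionTensorId (F : Y → S.carrier) : Y → MinTensor S.carrier S.carrier :=
  fun x => ∑ y, MinTensor.tmul (α (pointFunction y) x) (F y)

/-- The map `id ⊗ Δ : C(Y) ⊗ A → C(Y) ⊗ A ⊗ A`. -/
def idTensorComul (F : Y → S.carrier) : Y → MinTensor S.carrier S.carrier :=
  fun x => S.comul (F x)

/-- A unital `*`-homomorphism `α : C(Y) → C(Y) ⊗ A` is a co-action of `(A, Δ)` if
`(α ⊗ id)α = (id ⊗ Δ)α` and `α(C(Y))(1 ⊗ A)` spans a dense subspace of `C(Y) ⊗ A`. -/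
structure IsCoaction : Prop where
  coassoc : ∀ f : Y → ℂ, coactionTensorId S α (α f) = idTensorComul S (α f)
  dense : Dense (Submodule.span ℂ
    {F | ∃ (f : Y → ℂ) (a : S.carrier), F = α f * functionTensor 1 a} : Set (Y → S.carrier))

/-- The matrix `(q^x_y)` of `α` in `B(L²(Y)) ⊗ A`, with `α(χ_y) = ∑ x, χ_x ⊗ q^x_y`. -/
def coactionMatrix : Matrix Y Y S.carrier := Matrix.of fun x y => α (pointFunction y) x

/-- The map `Ad_α(T) = α (T ⊗ 1) α^*` from `B(L²(Y))` to `B(L²(Y)) ⊗ A`, where `B(L²(Y))` is the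
algebra of matrices over `Y` and `B(L²(Y)) ⊗ A` is the algebra of matrices over `Y` with entries
in `A`. -/
def adCoaction (T : Matrix Y Y ℂ) : Matrix Y Y S.carrier :=
  coactionMatrix S α * T.map (algebraMap ℂ S.carrier) * (coactionMatrix S α).conjTranspose

end Coaction

/-! ### Multigraphs -/

/-- A finite multigraph with vertex set `V`, edge set `E`, source and target maps, and without
isolated vertices. -/
structure Multigraph (V : Type v) (E : Type w) where
  source : E → V
  target : E → V
  no_isolated : ∀ i, ∃ e, source e = i ∨ target e = i

namespace Multigraph

variable {V : Type v} {E : Type w} [Fintype V] [DecidableEq V] [Fintype E]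
  (G : Multigraph V E)

/-- The set `E^i_j` of edges from `i` to `j`. -/
def edges (i j : V) : Finset E := Finset.univ.filter fun e => G.source e = i ∧ G.target e = j

/-- The maximal number `N` of edges from one vertex to another. -/
def maxMult : ℕ := Finset.univ.sup fun p : V × V => (G.edges p.1 p.2).card

/-- All nonempty sets `E^i_j` have the same number of elements. -/
def IsUniform : Prop := ∃ m, ∀ i j, (G.edges i j).card = 0 ∨ (G.edges i j).card = m

/-- An edge-labeling: for all `i` and `j` the edges from `i` to `j` are numbered
`0, …, |E^i_j| - 1`. An edge `e` from `i` to `j` with label `r` is denoted by `(i,j)r`. -/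
structure EdgeLabeling where
  label : E → Fin G.maxMult
  bijOn : ∀ i j, Set.BijOn label (G.edges i j : Set E) {r | (r : ℕ) < (G.edges i j).card}

variable {G} in
/-- `(i,j)r` is an edge. -/
def EdgeLabeling.IsEdge (l : G.EdgeLabeling) (i j : V) (r : Fin G.maxMult) : Prop :=
  ∃ e ∈ G.edges i j, l.label e = r

/-- The set `V × X_N`, so that `C(V) ⊗ C(X_N)` is the algebra of functions on it. -/
abbrev Fiber : Type v := V × Fin G.maxMult

open scoped Kronecker in
/-- The linear span of the `e_ij ⊗ f_rr` with `E^i_j` nonempty and `r` one of the first `|E^i_j|`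
elements of `X_N`, in `B(L²(V)) ⊗ B(L²(X_N))`. -/
def edgeSpace : Submodule ℂ (Matrix G.Fiber G.Fiber ℂ) :=
  Submodule.span ℂ {T | ∃ (i j : V) (r : Fin G.maxMult), (G.edges i j).Nonempty ∧
    (r : ℕ) < (G.edges i j).card ∧ T = Matrix.single i j 1 ⊗ₖ Matrix.single r r 1}

/-- The subspace `𝓔 ⊗ A` of `B(L²(V)) ⊗ B(L²(X_N)) ⊗ A`, where `𝓔` is `edgeSpace`. -/
def edgeSpaceTensor (A : Type u) [CStarAlgebra A] : Submodule ℂ (Matrix G.Fiber G.Fiber A) :=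
  Submodule.span ℂ {M | ∃ T ∈ G.edgeSpace, ∃ a : A, M = T.map fun c => c • a}

/-- The subspace `C(V) ⊗ 1 ⊗ A` of `C(V) ⊗ C(X_N) ⊗ A`. -/
def vertexTensor (A : Type u) [CStarAlgebra A] : Submodule ℂ (G.Fiber → A) :=
  Submodule.span ℂ {F | ∃ (f : V → ℂ) (a : A), F = functionTensor (fun p => f p.1) a}

/-- The objects `(A, Δ, α)` of the category `𝓒_(V,E)`: co-actions `α` of compact quantum groups
`(A, Δ)` on `C(V) ⊗ C(X_N)` with `α(C(V) ⊗ 1) ⊆ C(V) ⊗ 1 ⊗ A` and `Ad_α(𝓔) ⊆ 𝓔 ⊗ A`. -/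
structure CoactionObj where
  qgroup : CompactQuantumGroup.{u}
  coaction : (G.Fiber → ℂ) →⋆ₐ[ℂ] (G.Fiber → qgroup.carrier)
  isCoaction : IsCoaction qgroup coaction
  map_vertex : ∀ f : V → ℂ, coaction (fun p => f p.1) ∈ G.vertexTensor qgroup.carrier
  map_edge : ∀ T ∈ G.edgeSpace, adCoaction qgroup coaction T ∈ G.edgeSpaceTensor qgroup.carrier

variable {G} in
/-- The morphisms of `𝓒_(V,E)`: quantum group homomorphisms intertwining the co-actions,
`(id ⊗ f)α = α'`. -/
@[ext]
structure CoactionObj.Hom (X Y : CoactionObj.{u} G) : Type u where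
  hom : X.qgroup.carrier →⋆ₐ[ℂ] Y.qgroup.carrier
  isQuantumGroupHom : IsQuantumGroupHom X.qgroup Y.qgroup hom
  intertwines : ∀ (f : G.Fiber → ℂ) (p : G.Fiber), hom (X.coaction f p) = Y.coaction f p

instance CoactionObj.instCategory : CategoryTheory.Category (CoactionObj.{u} G) where
  Hom := CoactionObj.Hom
  id X := ⟨StarAlgHom.id ℂ X.qgroup.carrier, fun _ => rfl, fun _ _ => rfl⟩
  comp f g := ⟨g.hom.comp f.hom,
    fun a => (congrArg (MinTensor.map g.hom g.hom) (f.isQuantumGroupHom a)).trans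
      (g.isQuantumGroupHom (f.hom a)),
    fun h p => (congrArg g.hom (f.intertwines h p)).trans (g.intertwines h p)⟩

variable {G} in
/-- The defining relations for a family `q^x_y`, with `x = (k,s)` and `y = (i,r)`. -/
structure Relations (l : G.EdgeLabeling) (B : Type u) [CStarAlgebra B]
    (q : G.Fiber → G.Fiber → B) : Prop where
  isSelfAdjoint : ∀ x y, IsSelfAdjoint (q x y)
  isIdempotentElem : ∀ x y, IsIdempotentElem (q x y)
  sum_row : ∀ x, ∑ y, q x y = 1
  sum_col : ∀ y, ∑ x, q x y = 1
  vertex : ∀ k i s s', ∑ r, q (k, s) (i, r) = ∑ r, q (k, s') (i, r)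
  edge_empty : ∀ k l' i j s s' r, l.IsEdge i j r → G.edges k l' = ∅ →
    q (k, s) (i, r) * q (l', s') (j, r) = 0
  edge_ne : ∀ k l' i j s s' r, l.IsEdge i j r → (G.edges k l').Nonempty → s ≠ s' →
    q (k, s) (i, r) * q (l', s') (j, r) = 0

end Multigraph

/-- `A` is the universal unital C*-algebra generated by the elements `q` subject to the relations
`rel`: they generate `A` and satisfy the relations, and every family satisfying the relations in a
unital C*-algebra `B` is the image of `q` under a unique unital `*`-homomorphism `A → B`. -/
structure IsUniversalCStarAlgebra {ι : Type v}
    (rel : ∀ (B : Type u) [CStarAlgebra B], (ι → B) → Prop)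
    (A : Type u) [CStarAlgebra A] (q : ι → A) : Prop where
  rel_self : rel A q
  generates : (StarAlgebra.adjoin ℂ (Set.range q)).topologicalClosure = ⊤
  existsUnique_hom : ∀ (B : Type u) [CStarAlgebra B] (b : ι → B), rel B b →
    ∃! φ : A →⋆ₐ[ℂ] B, ∀ i, φ (q i) = b i

end

/-!
The universal C*-algebra of the relations exists because the relations force the generators to be
projections, hence contractions, and can be tested on a jointly injective family of representations:
take the closed `*`-algebra generated by the generic family inside a product of C*-algebras, one for
each norm on noncommutative polynomials that a solution of the relations induces
(`exists_isUniversalCStarAlgebra`).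

The relations are stable under `q ↦ ∑ z, q^x_z ⊗ q^z_y` (`Multigraph.Relations.comul`). This uses
uniformity: when `E^k_m` is nonempty every label in `X_N` is the label of an edge from `k` to `m`. The
universal property then gives the comultiplication. Coassociativity is an identity on
generators, and the density conditions hold because `q` is a magic unitary matrix, so that
`q_xw ⊗ 1 = ∑ y, Δ(q_xy)(1 ⊗ q_wy)` and `1 ⊗ q_wy = ∑ x, Δ(q_xy)(q_xw ⊗ 1)`.

For the universal property in the category, the matrix `u` of an arbitrary object has to satisfy the
relations. All of them can be read off directly from the co-action, except that the columns of `u`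
sum to `1` (`IsCoaction.sum_col_coactionMatrix`). This uses the density conditions for `Δ` and for
the co-action. By an averaging argument in the style of Woronowicz there is a state `h` with
`(h ⊗ id)Δ = h(·)1` on the coefficients of `u`: start from a state `ω` that is faithful on the
finite-dimensional space of coefficients, let `h` be a limit of Cesàro means of its convolution
powers, so that `ω * h = h = h * ω` (`PointedRep.exists_conv_invariant`), and use density of
`Δ(A)(1 ⊗ A)` to see that `h` absorbs all functionals in the representation of `ω`
(`PointedRep.inner_eval_comul_of_invariant`). The numbers `d_y = ∑ x, h(u_xy)` satisfy `uᵗ D u = D`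
for `D = diag(d)`. Together with the density condition for the co-action, which makes `u` an operator
with dense range, this forces `D` to be invertible and to commute with `u`, whence `uᵗ u = 1`.

States are handled through representations with a unit vector (`PointedRep`), obtained from the GNS
construction. Slices of elements of a minimal tensor product are then vectors in a Hilbert space, and
identities between them extend by continuity from elementary tensors.
-/

/-! ### Universal C*-algebras -/

section Universal

open scoped CStarAlgebra

theorem mem_starAdjoin_range_iff {ι : Type*} {A : Type*} [CStarAlgebra A] {a : ι → A}
    (ha : ∀ i, IsSelfAdjoint (a i)) (x : A) :
    x ∈ StarAlgebra.adjoin ℂ (Set.range a) ↔ ∃ p, FreeAlgebra.lift ℂ a p = x := by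
  have h : Set.range a ∪ star (Set.range a) = Set.range a := by
    refine Set.union_eq_left.2 fun y hy => ?_
    obtain ⟨i, hi⟩ := hy
    exact ⟨i, by rw [← (ha i).star_eq, hi, star_star]⟩
  rw [← StarSubalgebra.mem_toSubalgebra, StarAlgebra.adjoin_toSubalgebra, h,
    Algebra.adjoin_range_eq_range_freeAlgebra_lift, AlgHom.mem_range]

/-- An assignment on self-adjoint generators extends to a unital `*`-homomorphism as soon as it does
not increase the norm of any noncommutative polynomial in the generators. -/
theorem exists_starAlgHom_of_norm_lift_le {ι : Type*} {A B : Type*} [CStarAlgebra A]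
    [CStarAlgebra B] {a : ι → A} {b : ι → B}
    (ha : ∀ i, IsSelfAdjoint (a i)) (hb : ∀ i, IsSelfAdjoint (b i))
    (hgen : (StarAlgebra.adjoin ℂ (Set.range a)).topologicalClosure = ⊤)
    (h : ∀ p, ‖FreeAlgebra.lift ℂ b p‖ ≤ ‖FreeAlgebra.lift ℂ a p‖) :
    ∃ φ : A →⋆ₐ[ℂ] B, ∀ i, φ (a i) = b i := by
  -- The closed `*`-subalgebra of `A × B` generated by the pairs of generators is the graph of `φ`.
  let c : ι → A × B := fun i => (a i, b i)
  have hc : ∀ i, IsSelfAdjoint (c i) := fun i => Prod.ext (ha i).star_eq (hb i).star_eq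
  let G : StarSubalgebra ℂ (A × B) := (StarAlgebra.adjoin ℂ (Set.range c)).topologicalClosure
  have hcG : ∀ i, c i ∈ G := fun i =>
    StarSubalgebra.le_topologicalClosure _ (StarAlgebra.subset_adjoin ℂ _ ⟨i, rfl⟩)
  have hGclosed : IsClosed (G : Set (A × B)) := StarSubalgebra.isClosed_topologicalClosure _
  have hfst : ∀ p, (FreeAlgebra.lift ℂ c p).1 = FreeAlgebra.lift ℂ a p := fun p => by
    have : (AlgHom.fst ℂ A B).comp (FreeAlgebra.lift ℂ c) = FreeAlgebra.lift ℂ a := by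
      ext i; simp [c]
    exact congrArg (fun f => f p) this
  have hsnd : ∀ p, (FreeAlgebra.lift ℂ c p).2 = FreeAlgebra.lift ℂ b p := fun p => by
    have : (AlgHom.snd ℂ A B).comp (FreeAlgebra.lift ℂ c) = FreeAlgebra.lift ℂ b := by
      ext i; simp [c]
    exact congrArg (fun f => f p) this
  have hle : ∀ x ∈ G, ‖x.2‖ ≤ ‖x.1‖ := by
    have hcl : IsClosed {x : A × B | ‖x.2‖ ≤ ‖x.1‖} :=
      isClosed_le (by fun_prop) (by fun_prop)
    refine fun x hx => hcl.closure_subset_iff.2 (fun y hy => ?_)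
      (show x ∈ closure (StarAlgebra.adjoin ℂ (Set.range c) : Set (A × B)) from hx)
    obtain ⟨p, rfl⟩ := (mem_starAdjoin_range_iff hc y).1 hy
    simpa only [Set.mem_ofPred_eq, hfst, hsnd] using h p
  let ψ : G →⋆ₐ[ℂ] A := (StarAlgHom.fst ℂ A B).comp G.subtype
  let χ : G →⋆ₐ[ℂ] B := (StarAlgHom.snd ℂ A B).comp G.subtype
  have hiso : Isometry ψ := by
    refine AddMonoidHomClass.isometry_of_norm _ fun x => ?_
    change ‖(x : A × B).1‖ = ‖(x : A × B)‖
    rw [Prod.norm_def, max_eq_left (hle x x.2)]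
  have : CompleteSpace G := hGclosed.completeSpace_coe
  have hsurj : Function.Surjective ψ := by
    have hr : (StarAlgebra.adjoin ℂ (Set.range a)).topologicalClosure ≤ ψ.range := by
      refine StarSubalgebra.topologicalClosure_minimal (StarAlgebra.adjoin_le ?_)
        hiso.isClosedEmbedding.isClosed_range
      rintro _ ⟨i, rfl⟩
      exact ⟨⟨c i, hcG i⟩, rfl⟩
    rw [hgen] at hr
    exact fun x => hr (StarSubalgebra.mem_top)
  let e : G ≃⋆ₐ[ℂ] A := StarAlgEquiv.ofBijective ψ ⟨hiso.injective, hsurj⟩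
  refine ⟨χ.comp (e.symm : A →⋆ₐ[ℂ] G), fun i => ?_⟩
  have : e.symm (a i) = ⟨c i, hcG i⟩ := by
    rw [StarAlgEquiv.symm_apply_eq]; rfl
  change χ (e.symm (a i)) = b i
  rw [this]
  rfl

/-- Two unital `*`-homomorphisms that agree on topological generators are equal. -/
theorem StarAlgHom.ext_of_topologicalClosure_adjoin_eq_top {ι : Type*} {A B : Type*}
    [CStarAlgebra A] [CStarAlgebra B] {a : ι → A}
    (hgen : (StarAlgebra.adjoin ℂ (Set.range a)).topologicalClosure = ⊤)
    {φ ψ : A →⋆ₐ[ℂ] B} (h : ∀ i, φ (a i) = ψ (a i)) : φ = ψ := by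
  have hle : (StarAlgebra.adjoin ℂ (Set.range a)).topologicalClosure ≤
      StarAlgHom.equalizer φ ψ := by
    refine StarSubalgebra.topologicalClosure_minimal (StarAlgebra.adjoin_le ?_)
      (isClosed_eq (map_continuous φ) (map_continuous ψ))
    rintro _ ⟨i, rfl⟩
    exact h i
  rw [hgen] at hle
  exact StarAlgHom.ext fun x => hle StarSubalgebra.mem_top

/-- The bounded families of elements of nonzero unital C*-algebras form a C*-algebra. -/
noncomputable instance lp.instCStarAlgebraInfty {J : Type*} {B : J → Type*}
    [∀ j, CStarAlgebra (B j)] [∀ j, Nontrivial (B j)] : CStarAlgebra (lp B ∞) where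

/-- Evaluation of bounded families at an index. -/
def lp.evalStarAlgHom {J : Type*} (B : J → Type*) [∀ j, CStarAlgebra (B j)]
    [∀ j, Nontrivial (B j)] (j : J) : lp B ∞ →⋆ₐ[ℂ] B j where
  toFun x := x j
  map_one' := rfl
  map_mul' _ _ := rfl
  map_zero' := rfl
  map_add' _ _ := rfl
  commutes' _ := rfl
  map_star' _ := rfl

/-- The `*`-homomorphism into bounded families with the given components. -/
def lp.piStarAlgHom {J : Type*} {A : Type*} {B : J → Type*} [CStarAlgebra A]
    [∀ j, CStarAlgebra (B j)] [∀ j, Nontrivial (B j)] (φ : ∀ j, A →⋆ₐ[ℂ] B j) :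
    A →⋆ₐ[ℂ] lp B ∞ where
  toFun a := ⟨fun j => φ j a, memℓp_infty ⟨‖a‖, by
    rintro _ ⟨j, rfl⟩
    exact NonUnitalStarAlgHom.norm_apply_le (φ j) a⟩⟩
  map_one' := lp.ext (funext fun j => map_one (φ j))
  map_mul' a b := lp.ext (funext fun j => map_mul (φ j) a b)
  map_zero' := lp.ext (funext fun j => map_zero (φ j))
  map_add' a b := lp.ext (funext fun j => map_add (φ j) a b)
  commutes' r := lp.ext (funext fun j => AlgHomClass.commutes (φ j) r)
  map_star' a := lp.ext (funext fun j => map_star (φ j) a)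

/-- The elements of a set generate, topologically, the closed `*`-subalgebra they span. -/
theorem topologicalClosure_adjoin_codRestrict_eq_top {ι : Type*} {A : Type*} [CStarAlgebra A]
    (c : ι → A)
    (hc : ∀ i, c i ∈ (StarAlgebra.adjoin ℂ (Set.range c)).topologicalClosure) :
    (StarAlgebra.adjoin ℂ (Set.range fun i =>
      (⟨c i, hc i⟩ : (StarAlgebra.adjoin ℂ (Set.range c)).topologicalClosure))).topologicalClosure
      = ⊤ := by
  set S := (StarAlgebra.adjoin ℂ (Set.range c)).topologicalClosure
  refine eq_top_iff.2 fun x _ => ?_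
  change x ∈ closure _
  rw [closure_subtype]
  have hx : (x : A) ∈ closure (StarAlgebra.adjoin ℂ (Set.range c) : Set A) := x.2
  refine closure_mono ?_ hx
  have : StarAlgebra.adjoin ℂ (Set.range c) ≤
      (StarAlgebra.adjoin ℂ (Set.range fun i => (⟨c i, hc i⟩ : S))).map S.subtype := by
    refine StarAlgebra.adjoin_le ?_
    rintro _ ⟨i, rfl⟩
    exact ⟨⟨c i, hc i⟩, StarAlgebra.subset_adjoin ℂ _ ⟨i, rfl⟩, rfl⟩
  exact this

/-- Relations that force finitely many generators to be self-adjoint contractions, and that can be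
tested on a jointly injective family of `*`-homomorphisms, define a universal C*-algebra. -/
theorem exists_isUniversalCStarAlgebra {ι : Type v} [Finite ι]
    (rel : ∀ (B : Type u) [CStarAlgebra B], (ι → B) → Prop)
    (hsa : ∀ (B : Type u) [CStarAlgebra B] (b : ι → B), rel B b → ∀ i, IsSelfAdjoint (b i))
    (hnorm : ∀ (B : Type u) [CStarAlgebra B] (b : ι → B), rel B b → ∀ i, ‖b i‖ ≤ 1)
    (hrel : ∀ (A : Type u) [CStarAlgebra A] (a : ι → A) (J : Type) (B : J → Type u)
      [∀ j, CStarAlgebra (B j)] (φ : ∀ j, A →⋆ₐ[ℂ] B j), (∀ x, (∀ j, φ j x = 0) → x = 0) →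
      (∀ j, rel (B j) fun i => φ j (a i)) → rel A a) :
    ∃ (A : Type u) (_ : CStarAlgebra A) (q : ι → A), IsUniversalCStarAlgebra rel A q := by
  obtain ⟨n, ⟨e⟩⟩ := Finite.exists_equiv_fin ι
  -- All families satisfying `rel` form a proper class, but the norms they induce on the
  -- noncommutative polynomials form a set, and one family is chosen for each of these norms.
  let J : Type := {N : FreeAlgebra ℂ (Fin n) → ℝ // ∃ (B : Type u) (_ : CStarAlgebra B)
    (_ : Nontrivial B) (b : ι → B), rel B b ∧
      ∀ p, N p = ‖FreeAlgebra.lift ℂ (b ∘ e.symm) p‖}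
  choose B instB instN b hb hN using fun N : J => N.2
  let c : ι → lp B ∞ := fun i => ⟨fun j => b j i, memℓp_infty ⟨1, by
    rintro _ ⟨j, rfl⟩
    exact hnorm _ _ (hb j) i⟩⟩
  let S : StarSubalgebra ℂ (lp B ∞) := (StarAlgebra.adjoin ℂ (Set.range c)).topologicalClosure
  have hcS : ∀ i, c i ∈ S := fun i =>
    StarSubalgebra.le_topologicalClosure _ (StarAlgebra.subset_adjoin ℂ _ ⟨i, rfl⟩)
  have hclosed : IsClosed (S : Set (lp B ∞)) := StarSubalgebra.isClosed_topologicalClosure _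
  let q : ι → S := fun i => ⟨c i, hcS i⟩
  let ev : ∀ j, S →⋆ₐ[ℂ] B j := fun j => (lp.evalStarAlgHom B j).comp S.subtype
  have hgen : (StarAlgebra.adjoin ℂ (Set.range q)).topologicalClosure = ⊤ :=
    topologicalClosure_adjoin_codRestrict_eq_top c hcS
  have hq : rel S q := hrel S q J B ev
    (fun x hx => Subtype.ext (lp.ext (funext fun j => hx j))) (fun j => hb j)
  refine ⟨S, inferInstance, q, hq, hgen, fun C _ d hd => ?_⟩
  refine existsUnique_of_exists_of_unique ?_ fun φ ψ hφ hψ =>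
    StarAlgHom.ext_of_topologicalClosure_adjoin_eq_top hgen fun i => (hφ i).trans (hψ i).symm
  rcases subsingleton_or_nontrivial C with hC | hC
  · exact ⟨{ toFun := fun _ => 0
             map_one' := Subsingleton.elim _ _
             map_mul' := fun _ _ => Subsingleton.elim _ _
             map_zero' := rfl
             map_add' := fun _ _ => Subsingleton.elim _ _
             commutes' := fun _ => Subsingleton.elim _ _
             map_star' := fun _ => Subsingleton.elim _ _ }, fun _ => Subsingleton.elim _ _⟩
  · let j : J := ⟨fun p => ‖FreeAlgebra.lift ℂ (d ∘ e.symm) p‖, C, inferInstance, hC, d, hd,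
      fun _ => rfl⟩
    have hrange : Set.range (q ∘ e.symm) = Set.range q := e.symm.surjective.range_comp q
    obtain ⟨φ, hφ⟩ := exists_starAlgHom_of_norm_lift_le (a := q ∘ e.symm) (b := d ∘ e.symm)
      (fun i => hsa _ _ hq _) (fun i => hsa _ _ hd _) (by rw [hrange, hgen]) fun p => by
        have h1 : FreeAlgebra.lift ℂ (b j ∘ e.symm) p =
            ev j (FreeAlgebra.lift ℂ (q ∘ e.symm) p) := by
          have : FreeAlgebra.lift ℂ (b j ∘ e.symm) =
              (ev j).toAlgHom.comp (FreeAlgebra.lift ℂ (q ∘ e.symm)) := by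
            ext i; simp; rfl
          exact congrArg (fun f => f p) this
        rw [show ‖FreeAlgebra.lift ℂ (d ∘ e.symm) p‖ = ‖FreeAlgebra.lift ℂ (b j ∘ e.symm) p‖ from
          hN j p, h1]
        exact NonUnitalStarAlgHom.norm_apply_le (ev j) _
    exact ⟨φ, fun i => by simpa using hφ (e i)⟩

end Universal

/-! ### Elementary tensors of Hilbert space operators -/

section HilbertTensorLemmas

variable {H K L : Type u}
  [NormedAddCommGroup H] [InnerProductSpace ℂ H]
  [NormedAddCommGroup K] [InnerProductSpace ℂ K]
  [NormedAddCommGroup L] [InnerProductSpace ℂ L]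

namespace HilbertTensor

theorem inner_tmul (ξ ξ' : H) (η η' : K) :
    inner ℂ (tmul ξ η) (tmul ξ' η') = inner ℂ ξ ξ' * inner ℂ η η' := by
  rw [tmul, tmul, LinearIsometry.inner_map_map, TensorProduct.inner_tmul]

theorem norm_tmul (ξ : H) (η : K) : ‖tmul ξ η‖ = ‖ξ‖ * ‖η‖ := by
  rw [tmul, LinearIsometry.norm_map, TensorProduct.norm_tmul]

/-- Closed additive properties of vectors may be checked on elementary tensors. -/
@[elab_as_elim]
theorem tmul_induction {p : HilbertTensor H K → Prop} (x : HilbertTensor H K)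
    (hp : IsClosed {x | p x}) (h0 : p 0) (hadd : ∀ x y, p x → p y → p (x + y))
    (htmul : ∀ ξ η, p (tmul ξ η)) : p x := by
  induction x using HilbertTensor.induction_on with
  | hp => exact hp
  | ih z =>
    induction z using TensorProduct.induction_on with
    | zero => simpa using h0
    | add a b ha hb => rw [map_add]; exact hadd _ _ ha hb
    | tmul ξ η => exact htmul ξ η

theorem clm_ext {M : Type*} [NormedAddCommGroup M] [NormedSpace ℂ M]
    {S T : HilbertTensor H K →L[ℂ] M} (h : ∀ ξ η, S (tmul ξ η) = T (tmul ξ η)) : S = T := by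
  ext x
  induction x using tmul_induction with
  | hp => exact isClosed_eq S.continuous T.continuous
  | h0 => simp
  | hadd x y hx hy => rw [map_add, map_add, hx, hy]
  | htmul ξ η => exact h ξ η

theorem ext_inner_tmul {x y : HilbertTensor H K}
    (h : ∀ ξ η, inner ℂ (tmul ξ η) x = inner ℂ (tmul ξ η) y) : x = y := by
  refine ext_inner_left ℂ fun z => ?_
  induction z using tmul_induction with
  | hp => apply isClosed_eq <;> fun_prop
  | h0 => simp
  | hadd a b ha hb => rw [inner_add_left, inner_add_left, ha, hb]
  | htmul ξ η => exact h ξ η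

variable (K) in
/-- The operator `K → H ⊗ K`, `η ↦ ξ ⊗ η`. -/
noncomputable def mkLeft (ξ : H) : K →L[ℂ] HilbertTensor H K :=
  (incl H K).toContinuousLinearMap.comp (TensorProduct.mkL ℂ H K ξ)

theorem mkLeft_apply (ξ : H) (η : K) : mkLeft K ξ η = tmul ξ η := rfl

theorem tmul_smul (c : ℂ) (ξ : H) (η : K) : tmul ξ (c • η) = c • tmul ξ η :=
  map_smul (mkLeft K ξ) c η

theorem smul_tmul (c : ℂ) (ξ : H) (η : K) : tmul (c • ξ) η = c • tmul ξ η := by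
  rw [tmul, ← TensorProduct.smul_tmul', map_smul, tmul]

theorem add_tmul (ξ ξ' : H) (η : K) : tmul (ξ + ξ') η = tmul ξ η + tmul ξ' η := by
  rw [tmul, TensorProduct.add_tmul, map_add, tmul, tmul]

theorem tmul_add (ξ : H) (η η' : K) : tmul ξ (η + η') = tmul ξ η + tmul ξ η' :=
  map_add (mkLeft K ξ) η η'

end HilbertTensor

open HilbertTensor

theorem opTensor_add_left (S S' : H →L[ℂ] H) (T : K →L[ℂ] K) :
    opTensor (S + S') T = opTensor S T + opTensor S' T :=
  clm_ext fun ξ η => by simp [opTensor_tmul, HilbertTensor.add_tmul]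

theorem opTensor_add_right (S : H →L[ℂ] H) (T T' : K →L[ℂ] K) :
    opTensor S (T + T') = opTensor S T + opTensor S T' :=
  clm_ext fun ξ η => by simp [opTensor_tmul, HilbertTensor.tmul_add]

theorem opTensor_smul_left (c : ℂ) (S : H →L[ℂ] H) (T : K →L[ℂ] K) :
    opTensor (c • S) T = c • opTensor S T :=
  clm_ext fun ξ η => by simp [opTensor_tmul, HilbertTensor.smul_tmul]

theorem opTensor_smul_right (c : ℂ) (S : H →L[ℂ] H) (T : K →L[ℂ] K) :
    opTensor S (c • T) = c • opTensor S T :=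
  clm_ext fun ξ η => by simp [opTensor_tmul, HilbertTensor.tmul_smul]

theorem opTensor_mul (S S' : H →L[ℂ] H) (T T' : K →L[ℂ] K) :
    opTensor (S * S') (T * T') = opTensor S T * opTensor S' T' :=
  clm_ext fun ξ η => by simp [opTensor_tmul]

theorem opTensor_one : opTensor (1 : H →L[ℂ] H) (1 : K →L[ℂ] K) = 1 :=
  clm_ext fun ξ η => by simp [opTensor_tmul]

theorem opTensor_star [CompleteSpace H] [CompleteSpace K] (S : H →L[ℂ] H) (T : K →L[ℂ] K) :
    opTensor (star S) (star T) = star (opTensor S T) :=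
  clm_ext fun ξ η => ext_inner_tmul fun ξ' η' => by
    simp only [ContinuousLinearMap.star_eq_adjoint, ContinuousLinearMap.adjoint_inner_right,
      opTensor_tmul, HilbertTensor.inner_tmul]

theorem inner_hilbertAssoc (x y : HilbertTensor (HilbertTensor H K) L) :
    inner ℂ (hilbertAssoc H K L x) (hilbertAssoc H K L y) = inner ℂ x y :=
  (LinearIsometry.mk (hilbertAssoc H K L).toLinearMap norm_hilbertAssoc).inner_map_map x y

end HilbertTensorLemmas

/-! ### Elementary tensors in the minimal tensor product -/

namespace MinTensor

variable {A B : Type u} [CStarAlgebra A] [CStarAlgebra B]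

theorem ext_eval {x y : MinTensor A B} (h : ∀ π ρ, eval π ρ x = eval π ρ y) : x = y :=
  Subtype.ext (lp.ext (funext fun p => h p.1 p.2))

theorem norm_eval_le (π : HilbertRep A) (ρ : HilbertRep B) (x : MinTensor A B) :
    ‖eval π ρ x‖ ≤ ‖x‖ :=
  lp.norm_apply_le_norm ENNReal.top_ne_zero x.1 (π, ρ)

theorem continuous_eval (π : HilbertRep A) (ρ : HilbertRep B) : Continuous (eval π ρ) :=
  AddMonoidHomClass.continuous_of_bound (eval π ρ) 1 fun x => by
    simpa using norm_eval_le π ρ x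

theorem norm_tmul_le (a : A) (b : B) : ‖tmul a b‖ ≤ ‖a‖ * ‖b‖ :=
  lp.norm_le_of_forall_le (by positivity) fun p =>
    (norm_opTensor_le _ _).trans (mul_le_mul (NonUnitalStarAlgHom.norm_apply_le p.1.hom a)
      (NonUnitalStarAlgHom.norm_apply_le p.2.hom b) (norm_nonneg _) (norm_nonneg _))

variable (A B) in
/-- The bilinear map `(a, b) ↦ a ⊗ b`. -/
noncomputable def mk : A →ₗ[ℂ] B →ₗ[ℂ] MinTensor A B :=
  LinearMap.mk₂ ℂ tmul
    (fun a a' b => ext_eval fun π ρ => by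
      simp only [map_add, eval_tmul, opTensor_add_left])
    (fun c a b => ext_eval fun π ρ => by
      simp only [map_smul, eval_tmul, opTensor_smul_left])
    (fun a b b' => ext_eval fun π ρ => by
      simp only [map_add, eval_tmul, opTensor_add_right])
    (fun c a b => ext_eval fun π ρ => by
      simp only [map_smul, eval_tmul, opTensor_smul_right])

theorem tmul_sum {ι : Type*} (s : Finset ι) (a : A) (b : ι → B) :
    tmul a (∑ i ∈ s, b i) = ∑ i ∈ s, tmul a (b i) :=
  map_sum (mk A B a) b s

theorem sum_tmul {ι : Type*} (s : Finset ι) (a : ι → A) (b : B) :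
    tmul (∑ i ∈ s, a i) b = ∑ i ∈ s, tmul (a i) b :=
  map_sum ((mk A B).flip b) a s

theorem smul_tmul (c : ℂ) (a : A) (b : B) : tmul (c • a) b = c • tmul a b :=
  map_smul ((mk A B).flip b) c a

theorem tmul_smul (c : ℂ) (a : A) (b : B) : tmul a (c • b) = c • tmul a b :=
  map_smul (mk A B a) c b

theorem zero_tmul (b : B) : (tmul 0 b : MinTensor A B) = 0 := map_zero ((mk A B).flip b)

theorem tmul_zero (a : A) : (tmul a 0 : MinTensor A B) = 0 := map_zero (mk A B a)

theorem tmul_mul_tmul (a a' : A) (b b' : B) :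
    tmul a b * tmul a' b' = tmul (a * a') (b * b') :=
  ext_eval fun π ρ => by simp only [map_mul, eval_tmul, opTensor_mul]

theorem star_tmul (a : A) (b : B) : star (tmul a b) = tmul (star a) (star b) :=
  ext_eval fun π ρ => by simp only [map_star, eval_tmul, opTensor_star]

theorem one_tmul_one : (tmul 1 1 : MinTensor A B) = 1 :=
  ext_eval fun π ρ => by simp only [map_one, eval_tmul, opTensor_one]

theorem continuous_tmul_left (b : B) : Continuous fun a : A => tmul a b :=
  AddMonoidHomClass.continuous_of_bound ((mk A B).flip b) ‖b‖ fun a => by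
    rw [mul_comm]; exact norm_tmul_le a b

theorem continuous_tmul_right (a : A) : Continuous fun b : B => tmul a b :=
  AddMonoidHomClass.continuous_of_bound (mk A B a) ‖a‖ fun b => norm_tmul_le a b

/-- The unital `*`-homomorphism `a ↦ a ⊗ 1`. -/
noncomputable def inclLeft : A →⋆ₐ[ℂ] MinTensor A B where
  toFun a := tmul a 1
  map_one' := one_tmul_one
  map_mul' a a' := by rw [tmul_mul_tmul, one_mul]
  map_zero' := zero_tmul 1
  map_add' a a' := map_add ((mk A B).flip 1) a a'
  commutes' c := by
    rw [Algebra.algebraMap_eq_smul_one, smul_tmul, one_tmul_one, Algebra.algebraMap_eq_smul_one]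
  map_star' a := by rw [star_tmul, star_one]

/-- The unital `*`-homomorphism `b ↦ 1 ⊗ b`. -/
noncomputable def inclRight : B →⋆ₐ[ℂ] MinTensor A B where
  toFun b := tmul 1 b
  map_one' := one_tmul_one
  map_mul' a a' := by rw [tmul_mul_tmul, one_mul]
  map_zero' := tmul_zero 1
  map_add' a a' := map_add (mk A B 1) a a'
  commutes' c := by
    rw [Algebra.algebraMap_eq_smul_one, tmul_smul, one_tmul_one, Algebra.algebraMap_eq_smul_one]
  map_star' a := by rw [star_tmul, star_one]

theorem inclLeft_apply (a : A) : (inclLeft a : MinTensor A B) = tmul a 1 := rfl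

theorem inclRight_apply (b : B) : (inclRight b : MinTensor A B) = tmul 1 b := rfl

theorem dense_span_tmul :
    Dense (Submodule.span ℂ {x | ∃ (a : A) (b : B), x = tmul a b} : Set (MinTensor A B)) := by
  -- The products of elementary tensors are elementary tensors, so their linear span is already the
  -- generated `*`-subalgebra.
  let P : Submodule ℂ (RepFamily A B) := Submodule.span ℂ {x | ∃ (a : A) (b : B), x = repTensor a b}
  have hP : ∀ x ∈ StarAlgebra.adjoin ℂ {x | ∃ (a : A) (b : B), x = repTensor a b}, x ∈ P := by
    intro x hx
    rw [← StarSubalgebra.mem_toSubalgebra, StarAlgebra.adjoin_toSubalgebra] at hx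
    have hstar : {x : RepFamily A B | ∃ (a : A) (b : B), x = repTensor a b} ∪
        star {x | ∃ (a : A) (b : B), x = repTensor a b} =
        {x | ∃ (a : A) (b : B), x = repTensor a b} := by
      refine Set.union_eq_left.2 ?_
      rintro y ⟨a, b, hy⟩
      refine ⟨star a, star b, ?_⟩
      rw [← star_star y, hy]
      exact congrArg Subtype.val (star_tmul a b)
    rw [hstar] at hx
    induction hx using Algebra.adjoin_induction with
    | mem x hx => exact Submodule.subset_span hx
    | algebraMap c =>
      rw [Algebra.algebraMap_eq_smul_one]
      exact P.smul_mem c (Submodule.subset_span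
        ⟨1, 1, (congrArg Subtype.val (one_tmul_one (A := A) (B := B))).symm⟩)
    | add x y _ _ hx hy => exact P.add_mem hx hy
    | mul x y _ _ hx hy =>
      have hmul : P * P ≤ P := by
        rw [Submodule.span_mul_span, Submodule.span_le]
        rintro _ ⟨_, ⟨a, b, rfl⟩, _, ⟨a', b', rfl⟩, rfl⟩
        exact Submodule.subset_span ⟨a * a', b * b', congrArg Subtype.val (tmul_mul_tmul a a' b b')⟩
      exact hmul (Submodule.mul_mem_mul hx hy)
  intro x
  refine (closure_subtype (p := fun y => y ∈ minTensorSubalgebra A B)).2 ?_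
  refine closure_mono (fun y hy => ?_) (show (x.1 : RepFamily A B) ∈ closure
    (StarAlgebra.adjoin ℂ {x | ∃ (a : A) (b : B), x = repTensor a b} : Set (RepFamily A B)) from x.2)
  let val : MinTensor A B →ₗ[ℂ] RepFamily A B :=
    { toFun := fun x => x.1, map_add' := fun _ _ => rfl, map_smul' := fun _ _ => rfl }
  have hPle : P ≤ (Submodule.span ℂ {x | ∃ (a : A) (b : B), x = tmul a b}).map val := by
    refine Submodule.span_le.2 ?_
    rintro _ ⟨a, b, rfl⟩
    exact ⟨tmul a b, Submodule.subset_span ⟨a, b, rfl⟩, rfl⟩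
  exact hPle (hP y hy)

/-- Closed additive properties may be checked on elementary tensors. -/
@[elab_as_elim]
theorem induction_on {p : MinTensor A B → Prop} (x : MinTensor A B)
    (hp : IsClosed {x | p x}) (h0 : p 0) (hadd : ∀ x y, p x → p y → p (x + y))
    (htmul : ∀ a b, p (tmul a b)) : p x := by
  refine hp.closure_subset_iff.2 (fun y hy => ?_) (dense_span_tmul x)
  change p y
  suffices h : ∀ c : ℂ, p (c • y) by simpa using h 1
  induction hy using Submodule.span_induction with
  | mem y hy => obtain ⟨a, b, rfl⟩ := hy; exact fun c => by rw [← smul_tmul]; exact htmul _ b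
  | zero => exact fun c => by rw [smul_zero]; exact h0
  | add y z _ _ hy hz => exact fun c => by rw [smul_add]; exact hadd _ _ (hy c) (hz c)
  | smul d y _ hy => exact fun c => by rw [smul_smul]; exact hy _

end MinTensor

/-! ### Iterated coproducts in triples of representations -/

section Coassociative

variable {A : Type u} [CStarAlgebra A] (Δ : A →⋆ₐ[ℂ] MinTensor A A) (π₁ π₂ π₃ : HilbertRep A)

/-- The representation `(π₁ ⊗ π₂)Δ ⊗ π₃` of `A ⊗ A`. -/
noncomputable def evalLeft : MinTensor A A →⋆ₐ[ℂ]
    (HilbertTensor (HilbertTensor π₁.space π₂.space) π₃.space →L[ℂ]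
      HilbertTensor (HilbertTensor π₁.space π₂.space) π₃.space) :=
  MinTensor.eval (HilbertRep.conv Δ π₁ π₂) π₃

/-- The representation `π₁ ⊗ (π₂ ⊗ π₃)Δ` of `A ⊗ A`. -/
noncomputable def evalRight : MinTensor A A →⋆ₐ[ℂ]
    (HilbertTensor π₁.space (HilbertTensor π₂.space π₃.space) →L[ℂ]
      HilbertTensor π₁.space (HilbertTensor π₂.space π₃.space)) :=
  MinTensor.eval π₁ (HilbertRep.conv Δ π₂ π₃)

theorem continuous_evalLeft : Continuous (evalLeft Δ π₁ π₂ π₃) := MinTensor.continuous_eval _ _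

theorem continuous_evalRight : Continuous (evalRight Δ π₁ π₂ π₃) := MinTensor.continuous_eval _ _

theorem evalLeft_tmul (a b : A) (x : HilbertTensor π₁.space π₂.space) (ξ : π₃.space) :
    evalLeft Δ π₁ π₂ π₃ (MinTensor.tmul a b) (HilbertTensor.tmul x ξ) =
      HilbertTensor.tmul (MinTensor.eval π₁ π₂ (Δ a) x) (π₃.hom b ξ) :=
  opTensor_tmul _ _ _ _

theorem evalRight_tmul (a b : A) (ξ : π₁.space) (x : HilbertTensor π₂.space π₃.space) :
    evalRight Δ π₁ π₂ π₃ (MinTensor.tmul a b) (HilbertTensor.tmul ξ x) =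
      HilbertTensor.tmul (π₁.hom a ξ) (MinTensor.eval π₂ π₃ (Δ b) x) :=
  opTensor_tmul _ _ _ _

variable {Δ}

theorem IsCoassociative.inner_evalLeft (hΔ : IsCoassociative Δ) (a : A) (ξ₁ η₁ : π₁.space)
    (ξ₂ η₂ : π₂.space) (ξ₃ η₃ : π₃.space) :
    inner ℂ (HilbertTensor.tmul (HilbertTensor.tmul ξ₁ ξ₂) ξ₃)
        (evalLeft Δ π₁ π₂ π₃ (Δ a) (HilbertTensor.tmul (HilbertTensor.tmul η₁ η₂) η₃)) =
      inner ℂ (HilbertTensor.tmul ξ₁ (HilbertTensor.tmul ξ₂ ξ₃))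
        (evalRight Δ π₁ π₂ π₃ (Δ a) (HilbertTensor.tmul η₁ (HilbertTensor.tmul η₂ η₃))) := by
  have h : (hilbertAssoc π₁.space π₂.space π₃.space).comp (evalLeft Δ π₁ π₂ π₃ (Δ a)) =
      (evalRight Δ π₁ π₂ π₃ (Δ a)).comp (hilbertAssoc π₁.space π₂.space π₃.space) := hΔ a π₁ π₂ π₃
  have h2 := congrArg (fun T => T (HilbertTensor.tmul (HilbertTensor.tmul η₁ η₂) η₃)) h
  simp only [ContinuousLinearMap.comp_apply, hilbertAssoc_tmul] at h2
  rw [← inner_hilbertAssoc, hilbertAssoc_tmul, h2]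

end Coassociative

/-! ### States and pointed representations -/

/-- A representation `π` with a unit vector `ξ`. It stands for the state `a ↦ ⟪ξ, π(a) ξ⟫`; by the GNS
construction every state is of this form. -/
structure PointedRep (A : Type u) [CStarAlgebra A] extends HilbertRep A where
  vec : space
  norm_vec : ‖vec‖ = 1

namespace PointedRep

variable {A B : Type u} [CStarAlgebra A] [CStarAlgebra B]

/-- The vector state `a ↦ ⟪ξ, π(a) ξ⟫`. -/
noncomputable def state (p : PointedRep A) : A →ₗ[ℂ] ℂ where
  toFun a := inner ℂ p.vec (p.hom a p.vec)
  map_add' a b := by simp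
  map_smul' c a := by simp

theorem state_apply (p : PointedRep A) (a : A) : p.state a = inner ℂ p.vec (p.hom a p.vec) := rfl

theorem norm_hom_apply_vec_le (p : PointedRep A) (a : A) : ‖p.hom a p.vec‖ ≤ ‖a‖ := by
  have h := ((p.hom a).le_opNorm p.vec).trans
    (mul_le_mul_of_nonneg_right (NonUnitalStarAlgHom.norm_apply_le p.hom a) (norm_nonneg _))
  rwa [p.norm_vec, mul_one] at h

theorem norm_state_le (p : PointedRep A) (a : A) : ‖p.state a‖ ≤ ‖a‖ := by
  have h := norm_inner_le_norm (𝕜 := ℂ) p.vec (p.hom a p.vec)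
  rw [p.norm_vec, one_mul] at h
  exact h.trans (p.norm_hom_apply_vec_le a)

theorem state_one (p : PointedRep A) : p.state 1 = 1 := by
  simp [state_apply, p.norm_vec]

theorem state_star_mul (p : PointedRep A) (a b : A) :
    p.state (star a * b) = inner ℂ (p.hom a p.vec) (p.hom b p.vec) := by
  rw [state_apply, map_mul, map_star, ContinuousLinearMap.star_eq_adjoint,
    mul_apply_eq_comp, ContinuousLinearMap.adjoint_inner_right]

theorem state_star_mul_self (p : PointedRep A) (a : A) :
    p.state (star a * a) = (‖p.hom a p.vec‖ : ℂ) ^ 2 := by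
  rw [state_star_mul, inner_self_eq_norm_sq_to_K]
  rfl

theorem hom_apply_vec_eq_zero_iff (p : PointedRep A) (a : A) :
    p.hom a p.vec = 0 ↔ p.state (star a * a) = 0 := by
  rw [state_star_mul_self]; simp

open scoped ComplexOrder in
theorem state_star_mul_self_nonneg (p : PointedRep A) (a : A) : 0 ≤ p.state (star a * a) := by
  rw [state_star_mul_self, ← Complex.ofReal_pow]
  exact Complex.zero_le_real.2 (sq_nonneg _)

open scoped ComplexOrder in
/-- The GNS construction: every state is a vector state. -/
theorem exists_state_eq (f : A →ₗ[ℂ] ℂ) (hf : ∀ a, 0 ≤ f (star a * a)) (h1 : f 1 = 1) :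
    ∃ p : PointedRep A, ∀ a, p.state a = f a := by
  let _ : PartialOrder A := CStarAlgebra.spectralOrder A
  have _ : StarOrderedRing A := CStarAlgebra.spectralOrderedRing A
  let g : A →ₚ[ℂ] ℂ := PositiveLinearMap.mk₀ f fun x hx => by
    obtain ⟨b, rfl⟩ := CStarAlgebra.nonneg_iff_eq_star_mul_self.1 hx
    exact hf b
  have hg : ∀ a, g a = f a := fun a => rfl
  let ξ : g.GNS := ((g.toPreGNS 1 : g.PreGNS) : g.GNS)
  have hinner : ∀ a : A, inner ℂ ξ (g.gnsStarAlgHom a ξ) = f a := fun a => by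
    change inner ℂ ξ (g.gnsNonUnitalStarAlgHom a ξ) = f a
    rw [PositiveLinearMap.gnsNonUnitalStarAlgHom_apply_coe, UniformSpace.Completion.inner_coe,
      PositiveLinearMap.preGNS_inner_def]
    simp [hg]
  have hξ : ‖ξ‖ = 1 := by
    have h := hinner 1
    rw [map_one, one_apply_eq_self, h1, inner_self_eq_norm_sq_to_K] at h
    have h2 : ‖ξ‖ ^ 2 = 1 := Complex.ofReal_injective (by simpa using h)
    exact (pow_eq_one_iff_of_nonneg (norm_nonneg _) two_ne_zero).1 h2
  have : Nontrivial g.GNS := ⟨ξ, 0, fun h => by simp [h] at hξ⟩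
  exact ⟨{ space := g.GNS, hom := g.gnsStarAlgHom, vec := ξ, norm_vec := hξ }, hinner⟩

open scoped ComplexOrder in
theorem exists_state_eq_midpoint (p q : PointedRep A) :
    ∃ r : PointedRep A, ∀ a, r.state a = (2 : ℂ)⁻¹ * (p.state a + q.state a) := by
  refine exists_state_eq ((2 : ℂ)⁻¹ • (p.state + q.state)) (fun a => ?_) ?_
  · have h2 : (0 : ℂ) ≤ 2⁻¹ := by
      rw [show (2 : ℂ)⁻¹ = ((2⁻¹ : ℝ) : ℂ) by norm_num]
      exact Complex.zero_le_real.2 (by norm_num)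
    exact mul_nonneg h2 (add_nonneg (p.state_star_mul_self_nonneg a)
      (q.state_star_mul_self_nonneg a))
  · simp only [LinearMap.smul_apply, LinearMap.add_apply, state_one, smul_eq_mul]
    norm_num

open scoped ComplexOrder in
/-- States separate the points of a C*-algebra: a nonzero `-a⋆a` lies outside the closed cone of
nonnegative elements, and a separating functional, made hermitian, is a multiple of a state. -/
theorem exists_hom_apply_vec_ne_zero {a : A} (ha : a ≠ 0) :
    ∃ p : PointedRep A, p.hom a p.vec ≠ 0 := by
  let _ : PartialOrder A := CStarAlgebra.spectralOrder A
  have _ : StarOrderedRing A := CStarAlgebra.spectralOrderedRing A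
  let C : ProperCone ℝ A :=
    { carrier := {x | 0 ≤ x}
      add_mem' := fun {x y} (hx : 0 ≤ x) (hy : 0 ≤ y) => show 0 ≤ x + y from add_nonneg hx hy
      zero_mem' := le_refl (0 : A)
      smul_mem' := fun c x (hx : 0 ≤ x) => show 0 ≤ (c : ℝ) • x from smul_nonneg c.2 hx
      isClosed' := CStarAlgebra.isClosed_nonneg }
  have hmem : ∀ x, x ∈ C ↔ 0 ≤ x := fun x => Iff.rfl
  have hnot : -(star a * a) ∉ C := fun h => by
    have h1 : star a * a = 0 :=
      le_antisymm (neg_nonneg.1 ((hmem _).1 h)) (star_mul_self_nonneg a)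
    exact ha ((CStarRing.star_mul_self_eq_zero_iff a).1 h1)
  obtain ⟨g, hg, hga⟩ := C.hyperplane_separation_point hnot
  have hg' : ∀ x : A, 0 ≤ g (star x * x) := fun x => hg _ ((hmem _).2 (star_mul_self_nonneg x))
  have hpos : 0 < g (star a * a) := by simpa using hga
  -- the hermitian complex functional that agrees with `g` on self-adjoint elements
  let f : A →ₗ[ℂ] ℂ :=
    { toFun := fun x => (g (realPart x : A) : ℂ) + g (imaginaryPart x : A) * Complex.I
      map_add' := fun x y => by simp; ring
      map_smul' := fun c x => by
        simp only [realPart_smul, imaginaryPart_smul, AddSubgroup.coe_sub, AddSubgroup.coe_add,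
          selfAdjoint.val_smul, map_sub, map_add, map_smul, smul_eq_mul, RingHom.id_apply]
        push_cast
        nth_rw 5 [← Complex.re_add_im c]
        ring_nf
        simp
        ring }
  have hf : ∀ x, IsSelfAdjoint x → f x = g x := fun x hx => by
    change (g (realPart x : A) : ℂ) + g (imaginaryPart x : A) * Complex.I = g x
    rw [hx.coe_realPart, hx.imaginaryPart]
    simp
  have hf' : ∀ x, 0 ≤ f (star x * x) := fun x => by
    rw [hf _ (IsSelfAdjoint.star_mul_self x)]
    exact Complex.zero_le_real.2 (hg' x)
  have h1 : 0 < g 1 := by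
    have hle : star a * a ≤ (‖star a * a‖ : ℝ) • (1 : A) := by
      rw [← Algebra.algebraMap_eq_smul_one]
      exact IsSelfAdjoint.le_algebraMap_norm_self (IsSelfAdjoint.star_mul_self a)
    have h := hg _ ((hmem _).2 (sub_nonneg.2 hle))
    rw [map_sub, map_smul, smul_eq_mul] at h
    by_contra hneg
    have : ‖star a * a‖ * g 1 ≤ 0 := mul_nonpos_of_nonneg_of_nonpos (norm_nonneg _) (not_lt.1 hneg)
    linarith
  have hf1 : f 1 = g 1 := hf 1 (IsSelfAdjoint.one A)
  obtain ⟨p, hp⟩ := exists_state_eq (((g 1 : ℂ)⁻¹) • f) (fun x => by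
      have : (0 : ℂ) ≤ (g 1 : ℂ)⁻¹ := by
        rw [← Complex.ofReal_inv]; exact Complex.zero_le_real.2 (inv_nonneg.2 h1.le)
      exact mul_nonneg this (hf' x)) (by
      rw [LinearMap.smul_apply, hf1, smul_eq_mul, inv_mul_cancel₀]
      exact_mod_cast h1.ne')
  refine ⟨p, fun h => ?_⟩
  rw [hom_apply_vec_eq_zero_iff, hp, LinearMap.smul_apply, hf _ (IsSelfAdjoint.star_mul_self a),
    smul_eq_mul] at h
  exact (mul_ne_zero (inv_ne_zero (by exact_mod_cast h1.ne')) (by exact_mod_cast hpos.ne')) h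

/-- The vectors `π(a) ξ`, linearly in `a`. -/
noncomputable def orbitMap (p : PointedRep A) : A →ₗ[ℂ] p.space where
  toFun a := p.hom a p.vec
  map_add' a b := by simp
  map_smul' c a := by simp

theorem mem_ker_orbitMap (p : PointedRep A) (a : A) :
    a ∈ LinearMap.ker p.orbitMap ↔ p.hom a p.vec = 0 := LinearMap.mem_ker

/-- On a finite-dimensional subspace some state is faithful: a state whose null space in the subspace
has minimal dimension, since averaging it with another state can only shrink that null space. -/
theorem exists_faithful_on [Nontrivial A] (S : Submodule ℂ A) [FiniteDimensional ℂ S] :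
    ∃ p : PointedRep A, ∀ a ∈ S, p.hom a p.vec = 0 → a = 0 := by
  obtain ⟨p₀, -⟩ := exists_hom_apply_vec_ne_zero (one_ne_zero (α := A))
  suffices h : ∀ (n : ℕ) (p : PointedRep A),
      Module.finrank ℂ ↥(LinearMap.ker p.orbitMap ⊓ S) ≤ n →
      ∃ p : PointedRep A, ∀ a ∈ S, p.hom a p.vec = 0 → a = 0 from h _ p₀ le_rfl
  intro n
  induction n with
  | zero =>
    intro p hp
    have : FiniteDimensional ℂ ↥(LinearMap.ker p.orbitMap ⊓ S) :=
      Submodule.finiteDimensional_of_le inf_le_right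
    have hbot := Submodule.finrank_eq_zero.1 (Nat.le_zero.1 hp)
    refine ⟨p, fun a ha h => ?_⟩
    exact (Submodule.mem_bot ℂ).1 (hbot ▸ ⟨(p.mem_ker_orbitMap a).2 h, ha⟩)
  | succ n ih =>
    intro p hp
    by_cases hfaith : ∀ a ∈ S, p.hom a p.vec = 0 → a = 0
    · exact ⟨p, hfaith⟩
    · push Not at hfaith
      obtain ⟨a, haS, hap, ha⟩ := hfaith
      obtain ⟨q, hq⟩ := exists_hom_apply_vec_ne_zero ha
      obtain ⟨r, hr⟩ := exists_state_eq_midpoint p q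
      have hker : ∀ b, r.hom b r.vec = 0 → p.hom b p.vec = 0 ∧ q.hom b q.vec = 0 := by
        intro b hb
        rw [hom_apply_vec_eq_zero_iff, hr, state_star_mul_self, state_star_mul_self] at hb
        have h2 : ‖p.hom b p.vec‖ ^ 2 + ‖q.hom b q.vec‖ ^ 2 = 0 := by
          have := (mul_eq_zero.1 hb).resolve_left (by norm_num)
          exact_mod_cast this
        constructor
        · rw [← norm_eq_zero, ← sq_eq_zero_iff]
          nlinarith [sq_nonneg ‖p.hom b p.vec‖, sq_nonneg ‖q.hom b q.vec‖]
        · rw [← norm_eq_zero, ← sq_eq_zero_iff]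
          nlinarith [sq_nonneg ‖p.hom b p.vec‖, sq_nonneg ‖q.hom b q.vec‖]
      refine ih r (Nat.lt_succ_iff.1 (lt_of_lt_of_le ?_ hp))
      have : FiniteDimensional ℂ ↥(LinearMap.ker p.orbitMap ⊓ S) :=
        Submodule.finiteDimensional_of_le inf_le_right
      refine Submodule.finrank_lt_finrank_of_lt (lt_of_le_of_ne (fun b hb => ?_) fun heq => ?_)
      · exact ⟨(p.mem_ker_orbitMap b).2 (hker b ((r.mem_ker_orbitMap b).1 hb.1)).1, hb.2⟩
      · have hmem : a ∈ LinearMap.ker p.orbitMap ⊓ S := ⟨(p.mem_ker_orbitMap a).2 hap, haS⟩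
        rw [← heq] at hmem
        exact hq (hker a ((r.mem_ker_orbitMap a).1 hmem.1)).2

/-! ### Product functionals and convolution of states -/

/-- The product functional `x ↦ ⟪ξ ⊗ η, (π ⊗ ρ)(x) (ξ ⊗ η)⟫`. -/
noncomputable def prod (p : PointedRep A) (q : PointedRep B) : MinTensor A B →ₗ[ℂ] ℂ where
  toFun x := inner ℂ (HilbertTensor.tmul p.vec q.vec)
    (MinTensor.eval p.toHilbertRep q.toHilbertRep x (HilbertTensor.tmul p.vec q.vec))
  map_add' a b := by simp
  map_smul' c a := by simp

theorem norm_tmul_vec (p : PointedRep A) (q : PointedRep B) :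
    ‖HilbertTensor.tmul p.vec q.vec‖ = 1 := by
  rw [HilbertTensor.norm_tmul, p.norm_vec, q.norm_vec, one_mul]

theorem norm_prod_le (p : PointedRep A) (q : PointedRep B) (x : MinTensor A B) :
    ‖p.prod q x‖ ≤ ‖x‖ := by
  have h := norm_inner_le_norm (𝕜 := ℂ) (HilbertTensor.tmul p.vec q.vec)
    (MinTensor.eval p.toHilbertRep q.toHilbertRep x (HilbertTensor.tmul p.vec q.vec))
  have h2 := (MinTensor.eval p.toHilbertRep q.toHilbertRep x).le_opNorm
    (HilbertTensor.tmul p.vec q.vec)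
  rw [norm_tmul_vec] at h h2
  rw [one_mul] at h
  rw [mul_one] at h2
  exact (h.trans h2).trans (MinTensor.norm_eval_le _ _ x)

theorem continuous_prod (p : PointedRep A) (q : PointedRep B) : Continuous (p.prod q) :=
  AddMonoidHomClass.continuous_of_bound (p.prod q) 1 fun x => by
    simpa using norm_prod_le p q x

theorem prod_tmul (p : PointedRep A) (q : PointedRep B) (a : A) (b : B) :
    p.prod q (MinTensor.tmul a b) = p.state a * q.state b := by
  change inner ℂ _ (MinTensor.eval _ _ _ _) = _
  rw [MinTensor.eval_tmul, opTensor_tmul, HilbertTensor.inner_tmul]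
  rfl

theorem prod_congr {p p' : PointedRep A} {q q' : PointedRep B}
    (hp : ∀ a, p.state a = p'.state a) (hq : ∀ b, q.state b = q'.state b) (x : MinTensor A B) :
    p.prod q x = p'.prod q' x := by
  induction x using MinTensor.induction_on with
  | hp => exact isClosed_eq (continuous_prod p q) (continuous_prod p' q')
  | h0 => simp
  | hadd x y hx hy => rw [map_add, map_add, hx, hy]
  | htmul a b => rw [prod_tmul, prod_tmul, hp, hq]

variable (Δ : A →⋆ₐ[ℂ] MinTensor A A)

/-- The convolution of two states. -/
noncomputable def conv (p q : PointedRep A) : PointedRep A where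
  toHilbertRep := HilbertRep.conv Δ p.toHilbertRep q.toHilbertRep
  vec := HilbertTensor.tmul p.vec q.vec
  norm_vec := norm_tmul_vec p q

theorem state_conv (p q : PointedRep A) (a : A) : (p.conv Δ q).state a = p.prod q (Δ a) := rfl

theorem state_conv_congr {p p' q q' : PointedRep A}
    (hp : ∀ a, p.state a = p'.state a) (hq : ∀ b, q.state b = q'.state b) (a : A) :
    (p.conv Δ q).state a = (p'.conv Δ q').state a :=
  prod_congr hp hq (Δ a)

variable {Δ}

theorem state_conv_assoc (hΔ : IsCoassociative Δ) (p q r : PointedRep A) (a : A) :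
    ((p.conv Δ q).conv Δ r).state a = (p.conv Δ (q.conv Δ r)).state a :=
  hΔ.inner_evalLeft p.toHilbertRep q.toHilbertRep r.toHilbertRep a _ _ _ _ _ _

end PointedRep

/-! ### Invariant states as limits of Cesàro means -/

section CesaroMeans

open Filter Topology

/-- The Cesàro means of a sequence of complex numbers. -/
noncomputable def cesaroMean (s : ℕ → ℂ) (N : ℕ) : ℂ :=
  ((N : ℂ) + 1)⁻¹ * ∑ n ∈ Finset.range (N + 1), s n

theorem norm_cesaroMean_le {s : ℕ → ℂ} {C : ℝ} (h : ∀ n, ‖s n‖ ≤ C) (N : ℕ) :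
    ‖cesaroMean s N‖ ≤ C := by
  have hN : ‖((N : ℂ) + 1)⁻¹‖ = ((N : ℝ) + 1)⁻¹ := by
    rw [norm_inv, ← Nat.cast_add_one, Complex.norm_natCast, Nat.cast_add_one]
  have hsum : ‖∑ n ∈ Finset.range (N + 1), s n‖ ≤ (N + 1) * C := by
    refine (norm_sum_le_of_le _ fun n _ => h n).trans ?_
    simp
  rw [cesaroMean, norm_mul, hN]
  have : (0 : ℝ) < N + 1 := by positivity
  rw [inv_mul_le_iff₀ this]
  exact hsum

theorem cesaroMean_add (s t : ℕ → ℂ) (N : ℕ) :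
    cesaroMean (fun n => s n + t n) N = cesaroMean s N + cesaroMean t N := by
  simp only [cesaroMean, Finset.sum_add_distrib, mul_add]

theorem cesaroMean_mul_left (c : ℂ) (s : ℕ → ℂ) (N : ℕ) :
    cesaroMean (fun n => c * s n) N = c * cesaroMean s N := by
  simp only [cesaroMean, ← Finset.mul_sum]; ring

theorem cesaroMean_mul_right (c : ℂ) (s : ℕ → ℂ) (N : ℕ) :
    cesaroMean (fun n => s n * c) N = cesaroMean s N * c := by
  simp only [cesaroMean, ← Finset.sum_mul]; ring

theorem cesaroMean_const (c : ℂ) (N : ℕ) : cesaroMean (fun _ => c) N = c := by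
  have : (N : ℂ) + 1 ≠ 0 := Nat.cast_add_one_ne_zero N
  simp [cesaroMean, this]

/-- Shifting a bounded sequence does not change the limits of its Cesàro means. -/
theorem tendsto_cesaroMean_succ_sub {s : ℕ → ℂ} {C : ℝ} (h : ∀ n, ‖s n‖ ≤ C) :
    Tendsto (fun N => cesaroMean (fun n => s (n + 1)) N - cesaroMean s N) atTop (𝓝 0) := by
  have heq : ∀ N, cesaroMean (fun n => s (n + 1)) N - cesaroMean s N =
      ((N : ℂ) + 1)⁻¹ * (s (N + 1) - s 0) := fun N => by
    rw [cesaroMean, cesaroMean, ← mul_sub, ← Finset.sum_sub_distrib, Finset.sum_range_sub]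
  refine squeeze_zero_norm (a := fun N : ℕ => (2 * C) * (1 / ((N : ℝ) + 1))) (fun N => ?_) ?_
  · rw [heq, norm_mul, norm_inv, ← Nat.cast_add_one, Complex.norm_natCast, Nat.cast_add_one,
      one_div, mul_comm]
    refine mul_le_mul_of_nonneg_right ((norm_sub_le _ _).trans ?_) (by positivity)
    linarith [h (N + 1), h 0]
  · simpa using tendsto_one_div_add_atTop_nhds_zero_nat.const_mul (2 * C)

/-- The limit of a bounded sequence along a fixed ultrafilter exists. -/
theorem exists_tendsto_hyperfilter {s : ℕ → ℂ} {C : ℝ} (h : ∀ n, ‖s n‖ ≤ C) :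
    ∃ z, Tendsto s (hyperfilter ℕ : Filter ℕ) (𝓝 z) := by
  have hmem : s ⁻¹' Metric.closedBall 0 C ∈ (hyperfilter ℕ : Filter ℕ) :=
    Filter.univ_mem' fun n => by simpa using h n
  obtain ⟨z, -, hz⟩ := (isCompact_closedBall (0 : ℂ) C).ultrafilter_le_nhds'
    ((hyperfilter ℕ).map s) hmem
  exact ⟨z, hz⟩

namespace PointedRep

variable {A B : Type u} [CStarAlgebra A] [CStarAlgebra B]

/-- Product functionals depend continuously on the states, for Cesàro means along an ultrafilter. -/
theorem tendsto_cesaroMean_prod {p : ℕ → PointedRep A} {q : ℕ → PointedRep B}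
    {p' : PointedRep A} {q' : PointedRep B} {l : Filter ℕ}
    (h : ∀ a b, Tendsto (cesaroMean fun n => (p n).state a * (q n).state b) l
      (𝓝 (p'.state a * q'.state b))) (x : MinTensor A B) :
    Tendsto (cesaroMean fun n => (p n).prod (q n) x) l (𝓝 (p'.prod q' x)) := by
  induction x using MinTensor.induction_on with
  | hp =>
    refine isClosed_iff_frequently.2 fun x hx => Metric.tendsto_nhds.2 fun ε hε => ?_
    obtain ⟨y, hy, hxy⟩ := (hx.and_eventually (Metric.ball_mem_nhds x (by positivity :
      0 < ε / 3))).exists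
    have hd : ‖x - y‖ < ε / 3 := by rw [← dist_eq_norm, dist_comm]; exact hxy
    filter_upwards [Metric.tendsto_nhds.1 hy (ε / 3) (by positivity)] with N hN
    have h1 : ‖cesaroMean (fun n => (p n).prod (q n) x) N -
        cesaroMean (fun n => (p n).prod (q n) y) N‖ ≤ ‖x - y‖ := by
      have : cesaroMean (fun n => (p n).prod (q n) x) N =
          cesaroMean (fun n => (p n).prod (q n) (x - y)) N +
          cesaroMean (fun n => (p n).prod (q n) y) N := by
        rw [← cesaroMean_add]; simp
      rw [this, add_sub_cancel_right]
      exact norm_cesaroMean_le (fun n => norm_prod_le _ _ _) N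
    have h2 : ‖p'.prod q' x - p'.prod q' y‖ ≤ ‖x - y‖ := by
      rw [← map_sub]; exact norm_prod_le _ _ _
    rw [dist_eq_norm] at hN ⊢
    calc _ = ‖(cesaroMean (fun n => (p n).prod (q n) x) N -
          cesaroMean (fun n => (p n).prod (q n) y) N) +
          (cesaroMean (fun n => (p n).prod (q n) y) N - p'.prod q' y) -
          (p'.prod q' x - p'.prod q' y)‖ := by congr 1; ring
      _ ≤ ‖x - y‖ + ‖cesaroMean (fun n => (p n).prod (q n) y) N - p'.prod q' y‖ + ‖x - y‖ :=
        (norm_sub_le _ _).trans (add_le_add ((norm_add_le _ _).trans (by gcongr)) h2)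
      _ < ε := by linarith
  | h0 =>
    simp only [map_zero]
    exact tendsto_const_nhds.congr fun N => (cesaroMean_const 0 N).symm
  | hadd x y hx hy =>
    simp only [map_add]
    refine (hx.add hy).congr fun N => ?_
    rw [← cesaroMean_add]
  | htmul a b => simpa only [prod_tmul] using h a b

/-- The convolution powers `ω, ω * ω, ω * (ω * ω), …` of a state. -/
noncomputable def convPow (Δ : A →⋆ₐ[ℂ] MinTensor A A) (p : PointedRep A) : ℕ → PointedRep A
  | 0 => p
  | n + 1 => p.conv Δ (convPow Δ p n)

theorem state_convPow_conv {Δ : A →⋆ₐ[ℂ] MinTensor A A} (hΔ : IsCoassociative Δ)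
    (p : PointedRep A) (n : ℕ) (a : A) :
    ((p.convPow Δ n).conv Δ p).state a = (p.convPow Δ (n + 1)).state a := by
  induction n generalizing a with
  | zero => rfl
  | succ n ih =>
    change ((p.conv Δ (p.convPow Δ n)).conv Δ p).state a = _
    rw [state_conv_assoc hΔ]
    exact state_conv_congr Δ (fun _ => rfl) ih a

open scoped ComplexOrder in
/-- A state `h` with `ω * h = h = h * ω`, as a limit of Cesàro means of convolution powers of `ω`. -/
theorem exists_conv_invariant {Δ : A →⋆ₐ[ℂ] MinTensor A A} (hΔ : IsCoassociative Δ)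
    (p : PointedRep A) : ∃ h : PointedRep A,
      (∀ a, (p.conv Δ h).state a = h.state a) ∧ ∀ a, (h.conv Δ p).state a = h.state a := by
  have hbd : ∀ (a : A) n, ‖(p.convPow Δ n).state a‖ ≤ ‖a‖ := fun a n => norm_state_le _ a
  choose f hf using fun a => exists_tendsto_hyperfilter (norm_cesaroMean_le (hbd a))
  have huniq : ∀ {s : ℕ → ℂ} {a b : ℂ}, Tendsto s (hyperfilter ℕ : Filter ℕ) (𝓝 a) →
      Tendsto s (hyperfilter ℕ : Filter ℕ) (𝓝 b) → a = b := fun h1 h2 =>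
    tendsto_nhds_unique h1 h2
  let F : A →ₗ[ℂ] ℂ :=
    { toFun := f
      map_add' := fun a b => huniq (hf (a + b)) (((hf a).add (hf b)).congr fun N => by
        rw [← cesaroMean_add]; simp)
      map_smul' := fun c a => huniq (hf (c • a)) (((hf a).const_mul c).congr fun N => by
        rw [← cesaroMean_mul_left]; simp) }
  obtain ⟨h, hh⟩ := exists_state_eq F (fun a => by
      refine ge_of_tendsto' (hf (star a * a)) fun N => ?_
      have hinv : (0 : ℂ) ≤ ((N : ℂ) + 1)⁻¹ := by
        rw [show ((N : ℂ) + 1)⁻¹ = (((N : ℝ) + 1)⁻¹ : ℝ) by push_cast; rfl]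
        exact Complex.zero_le_real.2 (by positivity)
      exact mul_nonneg hinv (Finset.sum_nonneg fun n _ => state_star_mul_self_nonneg _ a))
    (huniq (hf 1) (by simpa only [state_one, funext (cesaroMean_const 1)] using tendsto_const_nhds))
  have hlim : ∀ a, Tendsto (cesaroMean fun n => (p.convPow Δ n).state a) (hyperfilter ℕ : Filter ℕ)
      (𝓝 (h.state a)) := fun a => by rw [hh]; exact hf a
  have hshift : ∀ a, Tendsto (cesaroMean fun n => (p.convPow Δ (n + 1)).state a)
      (hyperfilter ℕ : Filter ℕ) (𝓝 (h.state a)) := fun a => by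
    have h1 := ((tendsto_cesaroMean_succ_sub (hbd a)).mono_left
      Nat.hyperfilter_le_atTop).add (hlim a)
    simpa using h1
  refine ⟨h, fun a => ?_, fun a => ?_⟩
  · refine huniq ?_ (hshift a)
    refine tendsto_cesaroMean_prod (p := fun _ => p) (q := fun n => p.convPow Δ n)
      (fun a b => ?_) (Δ a)
    simpa only [funext (cesaroMean_mul_left _ _)] using (hlim b).const_mul (p.state a)
  · refine huniq ?_ (hshift a)
    have h1 := tendsto_cesaroMean_prod (p := fun n => p.convPow Δ n) (q := fun _ => p) (p' := h)
      (q' := p) (l := (hyperfilter ℕ : Filter ℕ)) (fun a b => by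
        simpa only [funext (cesaroMean_mul_right _ _)] using (hlim a).mul_const (p.state b)) (Δ a)
    simpa only [← state_conv, state_convPow_conv hΔ] using h1

end PointedRep

end CesaroMeans

/-! ### Functionals absorbed by an invariant state -/

namespace PointedRep

variable {A : Type u} [CStarAlgebra A] {Δ : A →⋆ₐ[ℂ] MinTensor A A}

theorem prod_apply (p q : PointedRep A) (x : MinTensor A A) :
    p.prod q x = inner ℂ (HilbertTensor.tmul p.vec q.vec)
      (MinTensor.eval p.toHilbertRep q.toHilbertRep x (HilbertTensor.tmul p.vec q.vec)) := rfl

theorem eval_tmul_apply_tmul (π ρ : HilbertRep A) (a b : A) (ξ : π.space) (η : ρ.space) :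
    MinTensor.eval π ρ (MinTensor.tmul a b) (HilbertTensor.tmul ξ η) =
      HilbertTensor.tmul (π.hom a ξ) (ρ.hom b η) :=
  opTensor_tmul _ _ _ _

theorem norm_eval_comul_tmul_vec (p q : PointedRep A) (b : A) :
    (‖MinTensor.eval p.toHilbertRep q.toHilbertRep (Δ b) (HilbertTensor.tmul p.vec q.vec)‖ : ℂ) ^ 2
      = (p.conv Δ q).state (star b * b) :=
  (state_star_mul_self (p.conv Δ q) b).symm

/-- The slice of `(π_h ⊗ π_h)(x)(Ω ⊗ Ω)` by `Ω` in the first leg. On `x = ∑ aᵢ ⊗ bᵢ` it is the vector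
`π_h(b) Ω` of the element `b = ∑ h(aᵢ) bᵢ`. -/
noncomputable def sliceVec (h : PointedRep A) (x : MinTensor A A) : h.space :=
  (HilbertTensor.mkLeft h.space h.vec).adjoint
    (MinTensor.eval h.toHilbertRep h.toHilbertRep x (HilbertTensor.tmul h.vec h.vec))

variable (Δ) in
/-- The slice of `(π_h ⊗ (π_ω ⊗ π_h)Δ)(x)(Ω ⊗ ξ ⊗ Ω)` by `Ω` in the first leg. On `x = ∑ aᵢ ⊗ bᵢ` it
is `(π_ω ⊗ π_h)(Δ(b)) (ξ ⊗ Ω)` for the element `b = ∑ h(aᵢ) bᵢ`. -/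
noncomputable def sliceComulVec (p h : PointedRep A) (x : MinTensor A A) :
    HilbertTensor p.space h.space :=
  (HilbertTensor.mkLeft (HilbertTensor p.space h.space) h.vec).adjoint
    (evalRight Δ h.toHilbertRep p.toHilbertRep h.toHilbertRep x
      (HilbertTensor.tmul h.vec (HilbertTensor.tmul p.vec h.vec)))

theorem inner_sliceVec (h : PointedRep A) (x : MinTensor A A) (η : h.space) :
    inner ℂ η (h.sliceVec x) = inner ℂ (HilbertTensor.tmul h.vec η)
      (MinTensor.eval h.toHilbertRep h.toHilbertRep x (HilbertTensor.tmul h.vec h.vec)) := by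
  rw [sliceVec, ContinuousLinearMap.adjoint_inner_right, HilbertTensor.mkLeft_apply]

theorem inner_sliceComulVec (p h : PointedRep A) (x : MinTensor A A)
    (η : HilbertTensor p.space h.space) :
    inner ℂ η (sliceComulVec Δ p h x) = inner ℂ (HilbertTensor.tmul h.vec η)
      (evalRight Δ h.toHilbertRep p.toHilbertRep h.toHilbertRep x
        (HilbertTensor.tmul h.vec (HilbertTensor.tmul p.vec h.vec))) := by
  rw [sliceComulVec, ContinuousLinearMap.adjoint_inner_right, HilbertTensor.mkLeft_apply]

theorem continuous_sliceVec (h : PointedRep A) : Continuous h.sliceVec := by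
  have := MinTensor.continuous_eval h.toHilbertRep h.toHilbertRep
  unfold sliceVec
  fun_prop

theorem continuous_sliceComulVec (p h : PointedRep A) : Continuous (sliceComulVec Δ p h) := by
  have := continuous_evalRight Δ h.toHilbertRep p.toHilbertRep h.toHilbertRep
  unfold sliceComulVec
  fun_prop

theorem sliceVec_tmul (h : PointedRep A) (a b : A) :
    h.sliceVec (MinTensor.tmul a b) = h.state a • h.hom b h.vec := by
  refine ext_inner_left ℂ fun η => ?_
  rw [inner_sliceVec, eval_tmul_apply_tmul, HilbertTensor.inner_tmul, inner_smul_right]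
  rfl

theorem sliceComulVec_tmul (p h : PointedRep A) (a b : A) :
    sliceComulVec Δ p h (MinTensor.tmul a b) = h.state a •
      MinTensor.eval p.toHilbertRep h.toHilbertRep (Δ b) (HilbertTensor.tmul p.vec h.vec) := by
  refine ext_inner_left ℂ fun η => ?_
  rw [inner_sliceComulVec, evalRight_tmul, HilbertTensor.inner_tmul, inner_smul_right]
  rfl

theorem exists_sliceVec_eq (p h : PointedRep A) {x : MinTensor A A}
    (hx : x ∈ Submodule.span ℂ {x | ∃ a b : A, x = MinTensor.tmul a b}) :
    ∃ b : A, h.sliceVec x = h.hom b h.vec ∧ sliceComulVec Δ p h x =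
      MinTensor.eval p.toHilbertRep h.toHilbertRep (Δ b) (HilbertTensor.tmul p.vec h.vec) := by
  induction hx using Submodule.span_induction with
  | mem x hx =>
    obtain ⟨a, b, rfl⟩ := hx
    exact ⟨h.state a • b, by simp [sliceVec_tmul], by simp [sliceComulVec_tmul]⟩
  | zero => exact ⟨0, by simp [sliceVec], by simp [sliceComulVec]⟩
  | add x y _ _ hx hy =>
    obtain ⟨b, hb, hb'⟩ := hx
    obtain ⟨c, hc, hc'⟩ := hy
    refine ⟨b + c, ?_, ?_⟩
    · rw [map_add, add_apply, ← hb, ← hc]; simp [sliceVec]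
    · rw [map_add, map_add, add_apply, ← hb', ← hc']; simp [sliceComulVec]
  | smul c x _ hx =>
    obtain ⟨b, hb, hb'⟩ := hx
    refine ⟨c • b, ?_, ?_⟩
    · rw [map_smul, smul_apply, ← hb]; simp [sliceVec]
    · rw [map_smul, map_smul, smul_apply, ← hb']; simp [sliceComulVec]

theorem norm_sliceComulVec {p h : PointedRep A} (hl : ∀ a, (p.conv Δ h).state a = h.state a)
    (x : MinTensor A A) : ‖sliceComulVec Δ p h x‖ = ‖h.sliceVec x‖ := by
  refine (isClosed_eq (continuous_sliceComulVec p h).norm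
    h.continuous_sliceVec.norm).closure_subset_iff.2 (fun y hy => ?_) (MinTensor.dense_span_tmul x)
  obtain ⟨b, hb, hb'⟩ := exists_sliceVec_eq (Δ := Δ) p h hy
  have h2 := norm_eval_comul_tmul_vec (Δ := Δ) p h b
  rw [hl, state_star_mul_self] at h2
  change ‖sliceComulVec Δ p h y‖ = ‖h.sliceVec y‖
  rw [hb, hb']
  exact (sq_eq_sq₀ (norm_nonneg _) (norm_nonneg _)).1 (by exact_mod_cast h2)

theorem inner_evalLeft_tmul_vec {p h : PointedRep A} (hr : ∀ a, (h.conv Δ p).state a = h.state a)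
    (x : MinTensor A A) (η : h.space) :
    inner ℂ (HilbertTensor.tmul (HilbertTensor.tmul h.vec p.vec) η)
        (evalLeft Δ h.toHilbertRep p.toHilbertRep h.toHilbertRep x
          (HilbertTensor.tmul (HilbertTensor.tmul h.vec p.vec) h.vec)) =
      inner ℂ η (h.sliceVec x) := by
  induction x using MinTensor.induction_on with
  | hp =>
    have h1 := continuous_evalLeft Δ h.toHilbertRep p.toHilbertRep h.toHilbertRep
    have h2 := h.continuous_sliceVec
    apply isClosed_eq <;> fun_prop
  | h0 => simp [sliceVec]
  | hadd x y hx hy =>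
    rw [map_add, add_apply, inner_add_right, hx, hy, ← inner_add_right]
    simp [sliceVec, inner_add_right]
  | htmul a b =>
    rw [evalLeft_tmul, HilbertTensor.inner_tmul, sliceVec_tmul, inner_smul_right, ← hr, state_conv,
      prod_apply]

/-- The element `b = (h ⊗ id)Δ(a)` satisfies `Δ(b) = 1 ⊗ b` on the vector `ξ ⊗ Ω`, because
`(ω ⊗ h)` of the square of `Δ(b) - 1 ⊗ b` vanishes when `ω * h = h = h * ω`. -/
theorem sliceComulVec_comul (hΔ : IsCoassociative Δ) {p h : PointedRep A}
    (hl : ∀ a, (p.conv Δ h).state a = h.state a) (hr : ∀ a, (h.conv Δ p).state a = h.state a)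
    (a : A) : sliceComulVec Δ p h (Δ a) = HilbertTensor.tmul p.vec (h.sliceVec (Δ a)) := by
  have h1 : inner ℂ (HilbertTensor.tmul p.vec (h.sliceVec (Δ a))) (sliceComulVec Δ p h (Δ a)) =
      (‖h.sliceVec (Δ a)‖ : ℂ) ^ 2 := by
    rw [inner_sliceComulVec, ← hΔ.inner_evalLeft, inner_evalLeft_tmul_vec hr,
      inner_self_eq_norm_sq_to_K]
    rfl
  rw [← sub_eq_zero, ← norm_eq_zero, ← sq_eq_zero_iff, norm_sub_sq (𝕜 := ℂ), ← inner_conj_symm, h1,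
    norm_sliceComulVec hl, HilbertTensor.norm_tmul, p.norm_vec]
  have : RCLike.re ((starRingEnd ℂ) ((‖h.sliceVec (Δ a)‖ : ℂ) ^ 2)) = ‖h.sliceVec (Δ a)‖ ^ 2 := by
    rw [← Complex.ofReal_pow, Complex.conj_ofReal]; rfl
  rw [this]
  ring

/-- A state `h` with `ω * h = h = h * ω` absorbs every functional `ρ(a) = ⟪η, π_ω(a) ξ⟫` of the
representation of `ω`: `h * ρ = ρ(1) h`. The cancellation property enters through the density of the
linear span of `Δ(A)(1 ⊗ A)`. -/
theorem inner_eval_comul_of_invariant (hΔ : IsCoassociative Δ)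
    (hdense : Dense (Submodule.span ℂ
      {x | ∃ a b : A, x = Δ a * MinTensor.tmul 1 b} : Set (MinTensor A A)))
    {p h : PointedRep A} (hl : ∀ a, (p.conv Δ h).state a = h.state a)
    (hr : ∀ a, (h.conv Δ p).state a = h.state a) (η : p.space) (d : A) :
    inner ℂ (HilbertTensor.tmul h.vec η)
        (MinTensor.eval h.toHilbertRep p.toHilbertRep (Δ d) (HilbertTensor.tmul h.vec p.vec)) =
      inner ℂ η p.vec * h.state d := by
  have hcont := continuous_evalLeft Δ h.toHilbertRep p.toHilbertRep h.toHilbertRep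
  have hkey : ∀ x : MinTensor A A,
      inner ℂ (HilbertTensor.tmul (HilbertTensor.tmul h.vec η) h.vec)
        (evalLeft Δ h.toHilbertRep p.toHilbertRep h.toHilbertRep (star x)
          (HilbertTensor.tmul (HilbertTensor.tmul h.vec p.vec) h.vec)) =
      inner ℂ η p.vec * h.prod h (star x) := by
    intro x
    have hcl : IsClosed {x : MinTensor A A |
        inner ℂ (HilbertTensor.tmul (HilbertTensor.tmul h.vec η) h.vec)
          (evalLeft Δ h.toHilbertRep p.toHilbertRep h.toHilbertRep (star x)
            (HilbertTensor.tmul (HilbertTensor.tmul h.vec p.vec) h.vec)) =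
        inner ℂ η p.vec * h.prod h (star x)} := by
      have := continuous_prod h h
      apply isClosed_eq <;> fun_prop
    refine hcl.closure_subset_iff.2 (fun y hy => ?_) (hdense x)
    rw [Set.mem_ofPred_eq]
    induction hy using Submodule.span_induction with
    | mem y hy =>
      obtain ⟨a, b, rfl⟩ := hy
      rw [star_mul, MinTensor.star_tmul, star_one, ← map_star]
      set a' := star a
      have h1 : HilbertTensor.tmul (HilbertTensor.tmul h.vec η) (h.hom b h.vec) =
          star (evalLeft Δ h.toHilbertRep p.toHilbertRep h.toHilbertRep
            (MinTensor.tmul 1 (star b)))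
            (HilbertTensor.tmul (HilbertTensor.tmul h.vec η) h.vec) := by
        rw [← map_star, MinTensor.star_tmul, star_star, star_one, evalLeft_tmul]
        simp
      have h2 : HilbertTensor.tmul h.vec (h.hom b h.vec) =
          star (MinTensor.eval h.toHilbertRep h.toHilbertRep
            (MinTensor.tmul 1 (star b))) (HilbertTensor.tmul h.vec h.vec) := by
        rw [← map_star, MinTensor.star_tmul, star_star, star_one, eval_tmul_apply_tmul]
        simp
      have h3 := inner_sliceComulVec (Δ := Δ) p h (Δ a') (HilbertTensor.tmul η (h.hom b h.vec))
      rw [sliceComulVec_comul hΔ hl hr, HilbertTensor.inner_tmul, inner_sliceVec,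
        ← hΔ.inner_evalLeft, h1, h2, ContinuousLinearMap.star_eq_adjoint,
        ContinuousLinearMap.star_eq_adjoint, ContinuousLinearMap.adjoint_inner_left,
        ContinuousLinearMap.adjoint_inner_left] at h3
      rw [map_mul, prod_apply, map_mul]
      exact h3.symm
    | zero => simp
    | add y z _ _ hy hz =>
      rw [star_add, map_add, map_add, add_apply, inner_add_right, hy, hz, mul_add]
    | smul c y _ hy =>
      rw [star_smul, map_smul, map_smul, smul_apply, inner_smul_right, hy, smul_eq_mul]
      ring
  have h4 := hkey (star (MinTensor.tmul d 1))
  rw [star_star, evalLeft_tmul, HilbertTensor.inner_tmul, prod_tmul, state_one, mul_one, map_one,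
    one_apply_eq_self, inner_self_eq_norm_sq_to_K, h.norm_vec] at h4
  simpa using h4

end PointedRep

/-! ### The matrix of a co-action is magic unitary -/

section CoactionMatrix

variable {Y : Type v} [DecidableEq Y]

section

variable (S : CompactQuantumGroup.{u}) (α : (Y → ℂ) →⋆ₐ[ℂ] (Y → S.carrier))

theorem coactionMatrix_apply (x y : Y) : coactionMatrix S α x y = α (pointFunction y) x := rfl

theorem isSelfAdjoint_coactionMatrix (x y : Y) : IsSelfAdjoint (coactionMatrix S α x y) := by
  have h : star (pointFunction y) = pointFunction y := by
    ext z
    by_cases hz : z = y <;> simp [pointFunction, hz]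
  have h2 := congrFun (map_star α (pointFunction y)) x
  rw [h] at h2
  exact h2.symm

theorem coactionMatrix_mul (x y z : Y) :
    coactionMatrix S α x y * coactionMatrix S α x z =
      if y = z then coactionMatrix S α x y else 0 := by
  have h : pointFunction y * pointFunction z = if y = z then pointFunction y else 0 := by
    ext w
    by_cases hyz : y = z
    · subst hyz; by_cases hw : w = y <;> simp [pointFunction, hw]
    · simp only [pointFunction, Pi.mul_apply, Pi.single_apply, hyz, if_false, Pi.zero_apply]
      by_cases hw : w = y
      · simp [hw, hyz]
      · simp [hw]
  have h2 := congrFun (map_mul α (pointFunction y) (pointFunction z)) x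
  rw [h] at h2
  rw [coactionMatrix_apply, coactionMatrix_apply, ← Pi.mul_apply, ← h2]
  split_ifs <;> simp

theorem isIdempotentElem_coactionMatrix (x y : Y) : IsIdempotentElem (coactionMatrix S α x y) := by
  rw [IsIdempotentElem, coactionMatrix_mul, if_pos rfl]

end

variable [Fintype Y]

theorem sum_smul_pointFunction (f : Y → ℂ) : ∑ y, f y • pointFunction y = f := by
  ext x
  simp [pointFunction, Finset.sum_apply, Pi.single_apply]

variable (S : CompactQuantumGroup.{u}) (α : (Y → ℂ) →⋆ₐ[ℂ] (Y → S.carrier))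

theorem coaction_apply (f : Y → ℂ) (x : Y) : α f x = ∑ y, f y • coactionMatrix S α x y := by
  conv_lhs => rw [← sum_smul_pointFunction f]
  simp [coactionMatrix_apply, Finset.sum_apply]

theorem sum_row_coactionMatrix (x : Y) : ∑ y, coactionMatrix S α x y = 1 := by
  have h := coaction_apply S α 1 x
  rw [map_one] at h
  simpa using h.symm

variable {S α}

namespace IsCoaction

variable (hα : IsCoaction S α)
include hα

theorem comul_coactionMatrix (x y : Y) : S.comul (coactionMatrix S α x y) =
    ∑ z, MinTensor.tmul (coactionMatrix S α x z) (coactionMatrix S α z y) :=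
  (congrFun (hα.coassoc (pointFunction y)) x).symm

theorem dense_range : Dense (Set.range fun (a : Y → S.carrier) (x : Y) =>
    ∑ y, coactionMatrix S α x y * a y) := by
  let T : (Y → S.carrier) →ₗ[ℂ] (Y → S.carrier) :=
    { toFun := fun a x => ∑ y, coactionMatrix S α x y * a y
      map_add' := fun a b => by ext x; simp [mul_add, Finset.sum_add_distrib]
      map_smul' := fun c a => by ext x; simp [Finset.smul_sum] }
  have hle : Submodule.span ℂ {F | ∃ (f : Y → ℂ) (a : S.carrier), F = α f * functionTensor 1 a} ≤
      LinearMap.range T := by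
    refine Submodule.span_le.2 ?_
    rintro _ ⟨f, a, rfl⟩
    refine ⟨fun y => f y • a, ?_⟩
    ext x
    simp only [T, LinearMap.coe_mk, AddHom.coe_mk, Pi.mul_apply, functionTensor, Pi.one_apply,
      one_smul]
    rw [coaction_apply, Finset.sum_mul]
    simp
  exact hα.dense.mono hle

/-- A state that is invariant under right convolution on the coefficients of the co-action. -/
theorem exists_invariant_state : ∃ h : PointedRep S.carrier, ∀ x y,
    ∑ z, h.state (coactionMatrix S α x z) • coactionMatrix S α z y =
      h.state (coactionMatrix S α x y) • (1 : S.carrier) := by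
  let P : Submodule ℂ S.carrier :=
    Submodule.span ℂ (insert 1 (Set.range fun p : Y × Y => coactionMatrix S α p.1 p.2))
  have hP1 : (1 : S.carrier) ∈ P := Submodule.subset_span (Set.mem_insert _ _)
  have hPu : ∀ x y, coactionMatrix S α x y ∈ P := fun x y =>
    Submodule.subset_span (Set.mem_insert_of_mem _ ⟨(x, y), rfl⟩)
  have : FiniteDimensional ℂ P :=
    FiniteDimensional.span_of_finite ℂ ((Set.finite_range _).insert 1)
  -- `ω` is faithful on the coefficients, so an identity that holds on its cyclic vector is true.
  obtain ⟨p, hp⟩ := PointedRep.exists_faithful_on P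
  obtain ⟨h, hl, hr⟩ := PointedRep.exists_conv_invariant S.coassoc p
  refine ⟨h, fun x y => sub_eq_zero.1 (hp _ (P.sub_mem
    (P.sum_mem fun z _ => P.smul_mem _ (hPu z y)) (P.smul_mem _ hP1)) ?_)⟩
  refine ext_inner_left ℂ fun η => ?_
  have hkey := PointedRep.inner_eval_comul_of_invariant S.coassoc S.dense_right hl hr η
    (coactionMatrix S α x y)
  rw [hα.comul_coactionMatrix, map_sum, sum_apply, inner_sum] at hkey
  simp only [PointedRep.eval_tmul_apply_tmul, HilbertTensor.inner_tmul,
    ← PointedRep.state_apply] at hkey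
  rw [map_sub, map_sum, sub_apply, sum_apply, inner_sub_right, inner_sum,
    inner_zero_right, sub_eq_zero, map_smul, map_one, smul_apply, one_apply_eq_self,
    inner_smul_right, mul_comm, ← hkey]
  simp [inner_smul_right]

/-- The columns of the matrix of a co-action also sum to `1`. With the invariant state `h` let
`d_y = ∑ x, h(u_xy)` and `D = diag(d)`; then `uᵗ D u = D`. Since the operator `u` on `A^Y` has dense
range, `h` detects that all `d_y` are nonzero, and `u D⁻¹ uᵗ = D⁻¹`. The diagonal of the last
equation shows that `u` commutes with `D`, so that `uᵗ u = 1`. -/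
theorem sum_col_coactionMatrix (y : Y) : ∑ x, coactionMatrix S α x y = 1 := by
  obtain ⟨h, hh⟩ := hα.exists_invariant_state
  have hdense := hα.dense_range
  have hsa := isSelfAdjoint_coactionMatrix S α
  have hmul := coactionMatrix_mul S α
  obtain ⟨q, hq⟩ : ∃ q : Y → Y → S.carrier, ∀ x y, coactionMatrix S α x y = q x y :=
    ⟨_, fun _ _ => rfl⟩
  simp only [hq] at hh hdense hsa hmul ⊢
  have hstate : ∀ x y, h.state (q x y) = (‖h.hom (q x y) h.vec‖ : ℂ) ^ 2 := fun x y => by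
    rw [← PointedRep.state_star_mul_self, (hsa x y).star_eq, hmul,
      if_pos rfl]
  let d : Y → ℂ := fun y => ∑ x, h.state (q x y)
  have hd : ∀ y, ∑ x, d x • q x y = d y • (1 : S.carrier) := fun y => by
    simp only [d, Finset.sum_smul]
    rw [Finset.sum_comm]
    exact Finset.sum_congr rfl fun x _ => hh x y
  have hzero : ∀ y, d y = 0 → ∀ x, h.hom (q x y) h.vec = 0 := fun y hy x => by
    have h0 : ∑ x, ‖h.hom (q x y) h.vec‖ ^ 2 = 0 := by
      have : ∑ x, (‖h.hom (q x y) h.vec‖ : ℂ) ^ 2 = 0 := by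
        simpa only [d, hstate] using hy
      exact_mod_cast this
    have := (Finset.sum_eq_zero_iff_of_nonneg fun x _ => sq_nonneg _).1 h0 x (Finset.mem_univ x)
    simpa using this
  -- the equation `uᵗ D u = D`, applied to a vector
  have hinv : ∀ (a : Y → S.carrier) y, ∑ x, d x • (q x y * ∑ z, q x z * a z) = d y • a y := by
    intro a y
    have h1 : ∀ x, q x y * ∑ z, q x z * a z = q x y * a y := fun x => by
      rw [Finset.mul_sum, Finset.sum_eq_single y]
      · rw [← mul_assoc, hmul, if_pos rfl]
      · intro z _ hz; rw [← mul_assoc, hmul, if_neg hz.symm, zero_mul]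
      · simp
    simp only [h1, ← smul_mul_assoc]
    rw [← Finset.sum_mul, hd, smul_mul_assoc, one_mul]
  have hdne : ∀ z, d z ≠ 0 := by
    intro z hz
    have hcont : Continuous h.state := AddMonoidHomClass.continuous_of_bound h.state 1 fun a => by
      simpa using h.norm_state_le a
    have hclosed : IsClosed {F : Y → S.carrier |
        h.state (F z) = ∑ y, (d y)⁻¹ * h.state (q z y * ∑ x, d x • (q x y * F x))} := by
      apply isClosed_eq <;> fun_prop
    have hall := hclosed.closure_subset_iff.2 (by
      rintro _ ⟨a, rfl⟩
      rw [Set.mem_ofPred_eq]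
      simp only [hinv]
      rw [map_sum]
      refine Finset.sum_congr rfl fun y _ => ?_
      by_cases hy : d y = 0
      · have : h.state (q z y * a y) = 0 := by
          rw [← (hsa z y).star_eq, PointedRep.state_star_mul, hzero y hy, inner_zero_left]
        rw [this, hy, inv_zero, zero_mul]
      · rw [mul_smul_comm, map_smul, smul_eq_mul, inv_mul_cancel_left₀ hy])
      (hdense (Pi.single z 1))
    rw [Set.mem_ofPred_eq, Pi.single_eq_same, PointedRep.state_one] at hall
    refine one_ne_zero (hall.trans (Finset.sum_eq_zero fun y _ => ?_))
    rw [Finset.sum_eq_zero, mul_zero, map_zero, mul_zero]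
    intro x _
    by_cases hx : x = z
    · rw [hx, hz, zero_smul]
    · rw [Pi.single_eq_of_ne hx, mul_zero, smul_zero]
  have hdiag : ∀ z, ∑ y, (d y)⁻¹ • q z y = (d z)⁻¹ • (1 : S.carrier) := by
    intro z
    have hclosed : IsClosed {F : Y → S.carrier |
        F z = ∑ y, (d y)⁻¹ • (q z y * ∑ x, d x • (q x y * F x))} := by
      apply isClosed_eq <;> fun_prop
    have hall := hclosed.closure_subset_iff.2 (by
      rintro _ ⟨a, rfl⟩
      rw [Set.mem_ofPred_eq]
      simp only [hinv]
      refine Finset.sum_congr rfl fun y _ => ?_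
      rw [mul_smul_comm, inv_smul_smul₀ (hdne y)])
      (hdense (Pi.single z 1))
    rw [Set.mem_ofPred_eq, Pi.single_eq_same] at hall
    rw [eq_inv_smul_iff₀ (hdne z), Finset.smul_sum]
    refine Eq.trans (Finset.sum_congr rfl fun y _ => ?_) hall.symm
    rw [Finset.sum_eq_single z, Pi.single_eq_same, mul_one, mul_smul_comm, hmul, if_pos rfl,
      smul_comm]
    · intro x _ hx; rw [Pi.single_eq_of_ne hx, mul_zero, smul_zero]
    · simp
  have hcomm : ∀ x y, d x • q x y = d y • q x y := fun x y => by
    have h1 := congrArg (fun b => b * q x y) (hdiag x)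
    simp only [Finset.sum_mul, smul_mul_assoc, one_mul, hmul] at h1
    rw [Finset.sum_eq_single y (fun z _ hz => by rw [if_neg hz, smul_zero]) (by simp),
      if_pos rfl] at h1
    rwa [eq_inv_smul_iff₀ (hdne x), smul_comm, inv_smul_eq_iff₀ (hdne y)] at h1
  have h1 := hd y
  simp only [hcomm, ← Finset.smul_sum] at h1
  exact smul_right_injective _ (hdne y) h1

end IsCoaction

end CoactionMatrix

/-! ### Partitions of unity by projections -/

section Projections

variable {B : Type*} [CStarAlgebra B]

/-- Projections that sum to `1` are pairwise orthogonal. -/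
theorem mul_eq_zero_of_sum_eq_one {Y : Type*} [Fintype Y] {p : Y → B}
    (hsa : ∀ y, IsSelfAdjoint (p y)) (hidem : ∀ y, IsIdempotentElem (p y)) (hsum : ∑ y, p y = 1)
    {y z : Y} (hyz : y ≠ z) : p y * p z = 0 := by
  classical
  let _ : PartialOrder B := CStarAlgebra.spectralOrder B
  have _ : StarOrderedRing B := CStarAlgebra.spectralOrderedRing B
  have hsq : ∀ y, star (p y * p z) * (p y * p z) = p z * p y * p z := fun y => by
    rw [star_mul, (hsa y).star_eq, (hsa z).star_eq, mul_assoc, ← mul_assoc (p y) (p y), (hidem y).eq,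
      mul_assoc]
  have h1 : ∑ y ∈ Finset.univ.erase z, star (p y * p z) * (p y * p z) = 0 := by
    have h2 : ∑ y, star (p y * p z) * (p y * p z) = p z := by
      simp only [hsq]
      rw [← Finset.sum_mul, ← Finset.mul_sum, hsum, mul_one, (hidem z).eq]
    rw [← Finset.add_sum_erase _ _ (Finset.mem_univ z), hsq, (hidem z).eq, (hidem z).eq] at h2
    simpa using h2
  have h3 := (Finset.sum_eq_zero_iff_of_nonneg fun y _ => star_mul_self_nonneg _).1 h1 y
    (Finset.mem_erase.2 ⟨hyz, Finset.mem_univ y⟩)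
  exact (CStarRing.star_mul_self_eq_zero_iff _).1 h3

theorem norm_le_one_of_isIdempotentElem {p : B} (hsa : IsSelfAdjoint p)
    (hidem : IsIdempotentElem p) : ‖p‖ ≤ 1 := by
  have h := CStarRing.norm_star_mul_self (x := p)
  rw [hsa.star_eq, hidem.eq] at h
  by_contra hlt
  nlinarith [norm_nonneg p]

end Projections

namespace MinTensor

/-- A `*`-homomorphism into a minimal tensor product may be given by its components in all pairs of
representations, provided these are compatible on topological generators. -/
theorem exists_hom_of_eval {A B : Type u} [CStarAlgebra A] [CStarAlgebra B] {ι : Type*} {C : Type*}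
    [CStarAlgebra C] {c : ι → C}
    (hgen : (StarAlgebra.adjoin ℂ (Set.range c)).topologicalClosure = ⊤) (m : ι → MinTensor A B)
    (h : ∀ (π : HilbertRep A) (ρ : HilbertRep B), ∃ φ : C →⋆ₐ[ℂ]
      (HilbertTensor π.space ρ.space →L[ℂ] HilbertTensor π.space ρ.space),
      ∀ i, φ (c i) = eval π ρ (m i)) :
    ∃ φ : C →⋆ₐ[ℂ] MinTensor A B, ∀ i, φ (c i) = m i := by
  choose φ hφ using h
  let Φ : C →⋆ₐ[ℂ] RepFamily A B :=
    lp.piStarAlgHom fun p : HilbertRep A × HilbertRep B => φ p.1 p.2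
  have hΦ : ∀ i, Φ (c i) = (m i).1 := fun i => lp.ext (funext fun p => hφ p.1 p.2 i)
  have hcont : Continuous Φ := AddMonoidHomClass.continuous_of_bound Φ 1 fun x => by
    simpa using NonUnitalStarAlgHom.norm_apply_le Φ x
  have hmem : ∀ x, Φ x ∈ minTensorSubalgebra A B := by
    have hle : (StarAlgebra.adjoin ℂ (Set.range c)).topologicalClosure ≤
        (minTensorSubalgebra A B).comap Φ := by
      refine StarSubalgebra.topologicalClosure_minimal (StarAlgebra.adjoin_le ?_)
        ((minTensorSubalgebra.instIsClosed A B).preimage hcont)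
      rintro _ ⟨i, rfl⟩
      change Φ (c i) ∈ minTensorSubalgebra A B
      rw [hΦ]
      exact (m i).2
    rw [hgen] at hle
    exact fun x => hle StarSubalgebra.mem_top
  exact ⟨StarAlgHom.codRestrict Φ (minTensorSubalgebra A B) hmem,
    fun i => Subtype.ext (hΦ i)⟩

theorem dense_of_tmul_mem {A B : Type u} [CStarAlgebra A] [CStarAlgebra B]
    {P : Submodule ℂ (MinTensor A B)} (h : ∀ a b, tmul a b ∈ P.topologicalClosure) :
    Dense (P : Set (MinTensor A B)) := by
  intro x
  rw [← Submodule.topologicalClosure_coe]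
  induction x using MinTensor.induction_on with
  | hp => exact P.isClosed_topologicalClosure
  | h0 => exact P.topologicalClosure.zero_mem
  | hadd x y hx hy => exact P.topologicalClosure.add_mem hx hy
  | htmul a b => exact h a b

end MinTensor

/-! ### Magic unitary comultiplications -/

section Comul

open scoped CStarAlgebra

variable {A : Type u} [CStarAlgebra A] {Y : Type v} [Fintype Y] {q : Y → Y → A}
  {Δ : A →⋆ₐ[ℂ] MinTensor A A}

theorem dense_adjoin_of_topologicalClosure_eq_top {ι : Type*} {a : ι → A}
    (ha : ∀ i, IsSelfAdjoint (a i))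
    (h : (StarAlgebra.adjoin ℂ (Set.range a)).topologicalClosure = ⊤) :
    Dense (Algebra.adjoin ℂ (Set.range a) : Set A) := by
  intro x
  have hx : x ∈ (StarAlgebra.adjoin ℂ (Set.range a)).topologicalClosure := h ▸ StarSubalgebra.mem_top
  refine closure_mono (fun y hy => ?_) (show x ∈ closure
    (StarAlgebra.adjoin ℂ (Set.range a) : Set A) from hx)
  obtain ⟨p, rfl⟩ := (mem_starAdjoin_range_iff ha y).1 hy
  rw [Algebra.adjoin_range_eq_range_freeAlgebra_lift]
  exact ⟨p, rfl⟩

theorem isCoassociative_of_comul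
    (hdense : Dense (Algebra.adjoin ℂ (Set.range fun p : Y × Y => q p.1 p.2) : Set A))
    (hΔ : ∀ x y, Δ (q x y) = ∑ z, MinTensor.tmul (q x z) (q z y)) : IsCoassociative Δ := by
  intro a π₁ π₂ π₃
  change (hilbertAssoc π₁.space π₂.space π₃.space).comp (evalLeft Δ π₁ π₂ π₃ (Δ a)) =
    (evalRight Δ π₁ π₂ π₃ (Δ a)).comp (hilbertAssoc π₁.space π₂.space π₃.space)
  have hL := (continuous_evalLeft Δ π₁ π₂ π₃).comp (map_continuous Δ)
  have hR := (continuous_evalRight Δ π₁ π₂ π₃).comp (map_continuous Δ)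
  have hcl : IsClosed {a | (hilbertAssoc π₁.space π₂.space π₃.space).comp
      (evalLeft Δ π₁ π₂ π₃ (Δ a)) =
      (evalRight Δ π₁ π₂ π₃ (Δ a)).comp (hilbertAssoc π₁.space π₂.space π₃.space)} :=
    isClosed_eq (continuous_const.clm_comp hL) (hR.clm_comp continuous_const)
  refine hcl.closure_subset_iff.2 (fun b hb => ?_) (hdense a)
  rw [Set.mem_ofPred_eq]
  induction hb using Algebra.adjoin_induction with
  | mem b hb =>
    obtain ⟨⟨x, y⟩, rfl⟩ := hb
    refine HilbertTensor.clm_ext fun ζ ξ₃ => ?_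
    simp only [ContinuousLinearMap.comp_apply]
    induction ζ using HilbertTensor.tmul_induction with
    | hp =>
      have h1 : Continuous fun ζ : HilbertTensor π₁.space π₂.space =>
          HilbertTensor.tmul ζ ξ₃ := by
        have h2 : Continuous fun ζ : HilbertTensor π₁.space π₂.space => ζ ⊗ₜ[ℂ] ξ₃ := by fun_prop
        exact (HilbertTensor.incl _ _).continuous.comp h2
      apply isClosed_eq <;> fun_prop
    | h0 =>
      have : HilbertTensor.tmul (0 : HilbertTensor π₁.space π₂.space) ξ₃ = 0 := by
        simpa using HilbertTensor.smul_tmul 0 (0 : HilbertTensor π₁.space π₂.space) ξ₃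
      simp [this]
    | hadd ζ ζ' h h' => simp only [HilbertTensor.add_tmul, map_add, h, h']
    | htmul ξ₁ ξ₂ =>
      rw [hilbertAssoc_tmul]
      simp only [hΔ, map_sum, sum_apply, evalLeft_tmul, evalRight_tmul,
        PointedRep.eval_tmul_apply_tmul]
      have hl : ∀ (s : Finset Y) (f : Y → HilbertTensor π₁.space π₂.space) (ξ : π₃.space),
          HilbertTensor.tmul (∑ w ∈ s, f w) ξ = ∑ w ∈ s, HilbertTensor.tmul (f w) ξ := by
        intro s f ξ
        simp only [HilbertTensor.tmul, TensorProduct.sum_tmul, map_sum]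
      have hr : ∀ (s : Finset Y) (f : Y → HilbertTensor π₂.space π₃.space) (ξ : π₁.space),
          HilbertTensor.tmul ξ (∑ w ∈ s, f w) = ∑ w ∈ s, HilbertTensor.tmul ξ (f w) := by
        intro s f ξ
        simp only [HilbertTensor.tmul, TensorProduct.tmul_sum, map_sum]
      simp only [hl, hr, map_sum, hilbertAssoc_tmul]
      exact Finset.sum_comm
  | algebraMap c =>
    simp only [Algebra.algebraMap_eq_smul_one]
    ext ζ
    simp
  | add b c _ _ hb hc =>
    rw [map_add, map_add, map_add, ContinuousLinearMap.comp_add, ContinuousLinearMap.add_comp, hb,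
      hc]
  | mul b c _ _ hb hc =>
    rw [map_mul, map_mul, map_mul, ContinuousLinearMap.mul_def, ContinuousLinearMap.mul_def,
      ← ContinuousLinearMap.comp_assoc, hb, ContinuousLinearMap.comp_assoc, hc,
      ContinuousLinearMap.comp_assoc]

/-- If the first leg `ι₁(g)` of every generator lies in the span of `Δ(A) ι₂(A)`, and the two legs
commute, then so does the first leg of every element of the algebra they generate: the span is
invariant under left multiplication by `Δ(A)` and right multiplication by `ι₂(A)`. -/
theorem mem_span_comul_mul_of_mem_adjoin {M : Type*} [Ring M] [Algebra ℂ M] (δ ι₁ ι₂ : A →ₐ[ℂ] M)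
    (hcomm : ∀ a b, ι₁ a * ι₂ b = ι₂ b * ι₁ a) {s : Set A}
    (hs : ∀ g ∈ s, ι₁ g ∈ Submodule.span ℂ {x | ∃ a b, x = δ a * ι₂ b}) {a : A}
    (ha : a ∈ Algebra.adjoin ℂ s) (b : A) :
    ι₁ a * ι₂ b ∈ Submodule.span ℂ {x | ∃ a b, x = δ a * ι₂ b} := by
  set P := Submodule.span ℂ {x | ∃ a b, x = δ a * ι₂ b}
  have hleft : ∀ c, ∀ x ∈ P, δ c * x ∈ P := by
    intro c x hx
    induction hx using Submodule.span_induction with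
    | mem x hx =>
      obtain ⟨a, b, rfl⟩ := hx
      exact Submodule.subset_span ⟨c * a, b, by rw [map_mul, mul_assoc]⟩
    | zero => rw [mul_zero]; exact P.zero_mem
    | add x y _ _ hx hy => rw [mul_add]; exact P.add_mem hx hy
    | smul d x _ hx => rw [mul_smul_comm]; exact P.smul_mem d hx
  have hright : ∀ c, ∀ x ∈ P, x * ι₂ c ∈ P := by
    intro c x hx
    induction hx using Submodule.span_induction with
    | mem x hx =>
      obtain ⟨a, b, rfl⟩ := hx
      exact Submodule.subset_span ⟨a, b * c, by rw [map_mul, mul_assoc]⟩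
    | zero => rw [zero_mul]; exact P.zero_mem
    | add x y _ _ hx hy => rw [add_mul]; exact P.add_mem hx hy
    | smul d x _ hx => rw [smul_mul_assoc]; exact P.smul_mem d hx
  refine hright b _ ?_
  induction ha using Algebra.adjoin_induction with
  | mem g hg => exact hs g hg
  | algebraMap c =>
    rw [AlgHomClass.commutes, Algebra.algebraMap_eq_smul_one]
    exact P.smul_mem c (Submodule.subset_span ⟨1, 1, by rw [map_one, map_one, one_mul]⟩)
  | add a b _ _ ha hb => rw [map_add]; exact P.add_mem ha hb
  | mul a c _ _ ha hc =>
    rw [map_mul]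
    revert ha
    generalize ι₁ a = x
    intro hx
    induction hx using Submodule.span_induction with
    | mem x hx =>
      obtain ⟨e, f, rfl⟩ := hx
      rw [mul_assoc, ← hcomm]
      exact hleft e _ (hright f _ hc)
    | zero => rw [zero_mul]; exact P.zero_mem
    | add x y _ _ hx hy => rw [add_mul]; exact P.add_mem hx hy
    | smul d x _ hx => rw [smul_mul_assoc]; exact P.smul_mem d hx

theorem inclLeft_mul_inclRight (a b : A) :
    (MinTensor.inclLeft a * MinTensor.inclRight b : MinTensor A A) = MinTensor.tmul a b := by
  rw [MinTensor.inclLeft_apply, MinTensor.inclRight_apply, MinTensor.tmul_mul_tmul, mul_one, one_mul]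

theorem inclRight_mul_inclLeft (a b : A) :
    (MinTensor.inclRight b * MinTensor.inclLeft a : MinTensor A A) = MinTensor.tmul a b := by
  rw [MinTensor.inclLeft_apply, MinTensor.inclRight_apply, MinTensor.tmul_mul_tmul, mul_one, one_mul]

/-- The elementary tensors `q_xw ⊗ 1 = ∑ y, Δ(q_xy)(1 ⊗ q_wy)` lie in the span of `Δ(A)(1 ⊗ A)`. -/
theorem dense_comul_mul_right
    (hdense : Dense (Algebra.adjoin ℂ (Set.range fun p : Y × Y => q p.1 p.2) : Set A))
    (hΔ : ∀ x y, Δ (q x y) = ∑ z, MinTensor.tmul (q x z) (q z y))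
    (hrow : ∀ x, ∑ y, q x y = 1) (hidem : ∀ x y, IsIdempotentElem (q x y))
    (hcol : ∀ y x z, x ≠ z → q x y * q z y = 0) :
    Dense (Submodule.span ℂ
      {x | ∃ a b : A, x = Δ a * MinTensor.tmul 1 b} : Set (MinTensor A A)) := by
  classical
  set P := Submodule.span ℂ {x | ∃ a b : A, x = Δ a * MinTensor.tmul 1 b}
  have hadj : ∀ a ∈ Algebra.adjoin ℂ (Set.range fun p : Y × Y => q p.1 p.2), ∀ b,
      MinTensor.tmul a b ∈ P := fun a ha b => by
    rw [← inclLeft_mul_inclRight]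
    refine mem_span_comul_mul_of_mem_adjoin (Δ : A →ₐ[ℂ] MinTensor A A)
      (MinTensor.inclLeft : A →⋆ₐ[ℂ] MinTensor A A).toAlgHom
      (MinTensor.inclRight : A →⋆ₐ[ℂ] MinTensor A A).toAlgHom
      (fun a b => (inclLeft_mul_inclRight a b).trans (inclRight_mul_inclLeft a b).symm) ?_ ha b
    rintro _ ⟨⟨x, w⟩, rfl⟩
    have h1 : MinTensor.tmul (q x w) 1 = ∑ y, Δ (q x y) * MinTensor.tmul 1 (q w y) := by
      simp only [hΔ, Finset.sum_mul, MinTensor.tmul_mul_tmul, mul_one]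
      rw [Finset.sum_comm, Finset.sum_eq_single w]
      · simp only [(hidem w _).eq, ← MinTensor.tmul_sum, hrow]
      · intro z _ hz
        exact Finset.sum_eq_zero fun y _ => by rw [hcol y z w hz, MinTensor.tmul_zero]
      · simp
    change MinTensor.tmul (q x w) 1 ∈ P
    rw [h1]
    exact P.sum_mem fun y _ => Submodule.subset_span ⟨q x y, q w y, rfl⟩
  exact MinTensor.dense_of_tmul_mem fun a b =>
    (P.isClosed_topologicalClosure.preimage
      (MinTensor.continuous_tmul_left b)).closure_subset_iff.2
      (fun a ha => P.le_topologicalClosure (hadj a ha b)) (hdense a)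

/-- The elementary tensors `1 ⊗ q_wy = ∑ x, Δ(q_xy)(q_xw ⊗ 1)` lie in the span of `Δ(A)(A ⊗ 1)`. -/
theorem dense_comul_mul_left
    (hdense : Dense (Algebra.adjoin ℂ (Set.range fun p : Y × Y => q p.1 p.2) : Set A))
    (hΔ : ∀ x y, Δ (q x y) = ∑ z, MinTensor.tmul (q x z) (q z y))
    (hcol : ∀ y, ∑ x, q x y = 1) (hidem : ∀ x y, IsIdempotentElem (q x y))
    (hrow : ∀ x y z, y ≠ z → q x y * q x z = 0) :
    Dense (Submodule.span ℂ
      {x | ∃ a b : A, x = Δ a * MinTensor.tmul b 1} : Set (MinTensor A A)) := by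
  classical
  set P := Submodule.span ℂ {x | ∃ a b : A, x = Δ a * MinTensor.tmul b 1}
  have hadj : ∀ b ∈ Algebra.adjoin ℂ (Set.range fun p : Y × Y => q p.1 p.2), ∀ a,
      MinTensor.tmul a b ∈ P := fun b hb a => by
    rw [← inclRight_mul_inclLeft]
    refine mem_span_comul_mul_of_mem_adjoin (Δ : A →ₐ[ℂ] MinTensor A A)
      (MinTensor.inclRight : A →⋆ₐ[ℂ] MinTensor A A).toAlgHom
      (MinTensor.inclLeft : A →⋆ₐ[ℂ] MinTensor A A).toAlgHom
      (fun b a => (inclRight_mul_inclLeft a b).trans (inclLeft_mul_inclRight a b).symm) ?_ hb a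
    rintro _ ⟨⟨w, y⟩, rfl⟩
    have h1 : MinTensor.tmul 1 (q w y) = ∑ x, Δ (q x y) * MinTensor.tmul (q x w) 1 := by
      simp only [hΔ, Finset.sum_mul, MinTensor.tmul_mul_tmul, mul_one]
      rw [Finset.sum_comm, Finset.sum_eq_single w]
      · simp only [(hidem _ w).eq, ← MinTensor.sum_tmul, hcol]
      · intro z _ hz
        exact Finset.sum_eq_zero fun x _ => by rw [hrow x z w hz, MinTensor.zero_tmul]
      · simp
    change MinTensor.tmul 1 (q w y) ∈ P
    rw [h1]
    exact P.sum_mem fun x _ => Submodule.subset_span ⟨q x y, q x w, rfl⟩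
  exact MinTensor.dense_of_tmul_mem fun a b =>
    (P.isClosed_topologicalClosure.preimage
      (MinTensor.continuous_tmul_right a)).closure_subset_iff.2
      (fun b hb => P.le_topologicalClosure (hadj b hb a)) (hdense b)

end Comul

/-! ### The edge spaces of a uniform multigraph -/

namespace Multigraph

variable {V : Type v} {E : Type w} [Fintype V] [DecidableEq V] [Fintype E] {G : Multigraph V E}

theorem IsUniform.card_edges (hG : G.IsUniform) {i j : V} (h : (G.edges i j).Nonempty) :
    (G.edges i j).card = G.maxMult := by
  obtain ⟨m, hm⟩ := hG
  have hij := (hm i j).resolve_left h.card_pos.ne'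
  refine le_antisymm (Finset.le_sup (f := fun p : V × V => (G.edges p.1 p.2).card)
    (Finset.mem_univ (i, j))) (Finset.sup_le fun p _ => ?_)
  rcases hm p.1 p.2 with h0 | h0 <;> omega

theorem EdgeLabeling.isEdge_iff (l : G.EdgeLabeling) (i j : V) (r : Fin G.maxMult) :
    l.IsEdge i j r ↔ (r : ℕ) < (G.edges i j).card := by
  have h : r ∈ l.label '' (G.edges i j : Set E) ↔ r ∈ {r : Fin G.maxMult |
      (r : ℕ) < (G.edges i j).card} := by rw [(l.bijOn i j).image_eq]
  exact h

theorem EdgeLabeling.IsEdge.nonempty {l : G.EdgeLabeling} {i j : V} {r : Fin G.maxMult}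
    (h : l.IsEdge i j r) : (G.edges i j).Nonempty := by
  obtain ⟨e, he, -⟩ := h
  exact ⟨e, he⟩

theorem EdgeLabeling.isEdge_of_nonempty (l : G.EdgeLabeling) (hG : G.IsUniform) {i j : V}
    (h : (G.edges i j).Nonempty) (r : Fin G.maxMult) : l.IsEdge i j r := by
  rw [l.isEdge_iff, hG.card_edges h]
  exact r.2

open scoped Kronecker in
theorem single_kronecker_single_apply (i j k m : V) (r s t : Fin G.maxMult) :
    (Matrix.single i j (1 : ℂ) ⊗ₖ Matrix.single r r (1 : ℂ)) (k, s) (m, t) =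
      if (k, s) = (i, r) ∧ (m, t) = (j, r) then 1 else 0 := by
  rw [Matrix.kroneckerMap_apply, Matrix.single_apply, Matrix.single_apply]
  simp only [Prod.mk.injEq]
  split_ifs <;> grind

theorem apply_eq_zero_of_mem_edgeSpaceTensor {A : Type u} [CStarAlgebra A]
    {M : Matrix G.Fiber G.Fiber A} (hM : M ∈ G.edgeSpaceTensor A) {k m : V} {s t : Fin G.maxMult}
    (h : G.edges k m = ∅ ∨ s ≠ t) : M (k, s) (m, t) = 0 := by
  have hT : ∀ T ∈ G.edgeSpace, T (k, s) (m, t) = 0 := by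
    intro T hT
    induction hT using Submodule.span_induction with
    | mem T hT =>
      obtain ⟨i, j, r, hne, -, rfl⟩ := hT
      rw [single_kronecker_single_apply, if_neg]
      rintro ⟨h1, h2⟩
      simp only [Prod.mk.injEq] at h1 h2
      rcases h with h | h
      · rw [← h1.1, ← h2.1, h] at hne
        exact Finset.not_nonempty_empty hne
      · exact h (h1.2.trans h2.2.symm)
    | zero => rfl
    | add S T _ _ hS hT => rw [Matrix.add_apply, hS, hT, add_zero]
    | smul c T _ hT => rw [Matrix.smul_apply, hT, smul_zero]
  induction hM using Submodule.span_induction with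
  | mem M hM =>
    obtain ⟨T, hTm, a, rfl⟩ := hM
    rw [Matrix.map_apply, hT T hTm, zero_smul]
  | zero => rfl
  | add M N _ _ hM hN => rw [Matrix.add_apply, hM, hN, add_zero]
  | smul c M _ hM => rw [Matrix.smul_apply, hM, smul_zero]

open scoped Kronecker in
theorem single_mem_edgeSpace {i j : V} {r : Fin G.maxMult} (h : (r : ℕ) < (G.edges i j).card) :
    Matrix.single i j 1 ⊗ₖ Matrix.single r r 1 ∈ G.edgeSpace :=
  Submodule.subset_span ⟨i, j, r, Finset.card_pos.1 (by omega), h, rfl⟩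

open scoped Kronecker in
/-- For a uniform multigraph, `𝓔 ⊗ A` consists of all matrices that vanish outside the positions
`((k, s), (m, s))` with `E^k_m` nonempty. -/
theorem mem_edgeSpaceTensor (hG : G.IsUniform) {A : Type u} [CStarAlgebra A]
    {M : Matrix G.Fiber G.Fiber A}
    (h : ∀ k m s t, G.edges k m = ∅ ∨ s ≠ t → M (k, s) (m, t) = 0) : M ∈ G.edgeSpaceTensor A := by
  have hM : M = ∑ k, ∑ m, ∑ s, (Matrix.single k m (1 : ℂ) ⊗ₖ Matrix.single s s (1 : ℂ)).map
      fun c => c • M (k, s) (m, s) := by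
    ext ⟨k, s⟩ ⟨m, t⟩
    simp only [Matrix.sum_apply, Matrix.map_apply, single_kronecker_single_apply]
    rw [Finset.sum_eq_single k, Finset.sum_eq_single m, Finset.sum_eq_single s]
    · by_cases hst : s = t
      · subst hst; simp
      · rw [h k m s t (Or.inr hst), if_neg (by simp [Ne.symm hst]), zero_smul]
    · intro r _ hr; rw [if_neg (by simp [hr.symm]), zero_smul]
    · simp
    · intro j _ hj
      exact Finset.sum_eq_zero fun r _ => by rw [if_neg (by simp [hj.symm]), zero_smul]
    · simp
    · intro i _ hi
      exact Finset.sum_eq_zero fun j _ => Finset.sum_eq_zero fun r _ => by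
        rw [if_neg (by simp [hi.symm]), zero_smul]
    · simp
  rw [hM]
  refine Submodule.sum_mem _ fun k _ => Submodule.sum_mem _ fun m _ => Submodule.sum_mem _
    fun s _ => ?_
  rcases (G.edges k m).eq_empty_or_nonempty with he | he
  · have : (Matrix.single k m (1 : ℂ) ⊗ₖ Matrix.single s s (1 : ℂ)).map
        (fun c => c • M (k, s) (m, s)) = 0 := by
      ext x y; simp [h k m s s (Or.inl he)]
    rw [this]
    exact Submodule.zero_mem _
  · exact Submodule.subset_span ⟨_, single_mem_edgeSpace (by rw [hG.card_edges he]; exact s.2), _,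
      rfl⟩

open scoped Kronecker in
theorem adCoaction_single_apply (S : CompactQuantumGroup.{u})
    (α : (G.Fiber → ℂ) →⋆ₐ[ℂ] (G.Fiber → S.carrier)) (i j : V) (r : Fin G.maxMult)
    (x y : G.Fiber) :
    adCoaction S α (Matrix.single i j 1 ⊗ₖ Matrix.single r r 1) x y =
      coactionMatrix S α x (i, r) * coactionMatrix S α y (j, r) := by
  rw [adCoaction, Matrix.mul_apply, Finset.sum_eq_single (j, r), Matrix.mul_apply,
    Finset.sum_eq_single (i, r)]
  · rw [Matrix.map_apply, single_kronecker_single_apply, if_pos ⟨rfl, rfl⟩, map_one, mul_one,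
      Matrix.conjTranspose_apply, (isSelfAdjoint_coactionMatrix S α _ _).star_eq]
  · rintro ⟨k, s⟩ _ hz
    rw [Matrix.map_apply, single_kronecker_single_apply, if_neg fun h => hz h.1, map_zero, mul_zero]
  · simp
  · rintro ⟨k, s⟩ _ hz
    rw [Matrix.mul_apply, Finset.sum_eq_zero, zero_mul]
    rintro ⟨m, t⟩ _
    rw [Matrix.map_apply, single_kronecker_single_apply, if_neg fun h => hz h.2, map_zero, mul_zero]
  · simp

theorem apply_eq_of_mem_vertexTensor {A : Type u} [CStarAlgebra A] {F : G.Fiber → A}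
    (hF : F ∈ G.vertexTensor A) (k : V) (s t : Fin G.maxMult) : F (k, s) = F (k, t) := by
  induction hF using Submodule.span_induction with
  | mem F hF => obtain ⟨f, a, rfl⟩ := hF; rfl
  | zero => rfl
  | add F F' _ _ h h' => rw [Pi.add_apply, Pi.add_apply, h, h']
  | smul c F _ h => rw [Pi.smul_apply, Pi.smul_apply, h]

theorem mem_vertexTensor {A : Type u} [CStarAlgebra A] {F : G.Fiber → A}
    (h : ∀ k s t, F (k, s) = F (k, t)) : F ∈ G.vertexTensor A := by
  rcases isEmpty_or_nonempty (Fin G.maxMult) with hN | ⟨⟨r⟩⟩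
  · rw [show F = 0 from funext fun x => hN.elim x.2]
    exact Submodule.zero_mem _
  · have hF : F = ∑ k, functionTensor (fun p : G.Fiber => pointFunction k p.1) (F (k, r)) := by
      ext ⟨k, s⟩
      rw [Finset.sum_apply, Finset.sum_eq_single k]
      · simp [functionTensor, pointFunction, h k s r]
      · intro m _ hm
        simp [functionTensor, pointFunction, hm.symm]
      · simp
    rw [hF]
    exact Submodule.sum_mem _ fun k _ => Submodule.subset_span ⟨_, _, rfl⟩

/-! ### The defining relations -/

theorem Relations.map {l : G.EdgeLabeling} {B : Type*} [CStarAlgebra B] {C : Type*} [CStarAlgebra C]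
    {q : G.Fiber → G.Fiber → B} (h : Relations l B q) (φ : B →⋆ₐ[ℂ] C) :
    Relations l C fun x y => φ (q x y) where
  isSelfAdjoint x y := (h.isSelfAdjoint x y).map φ
  isIdempotentElem x y := (h.isIdempotentElem x y).map φ
  sum_row x := by rw [← map_sum, h.sum_row, map_one]
  sum_col y := by rw [← map_sum, h.sum_col, map_one]
  vertex k i s s' := by rw [← map_sum, ← map_sum, h.vertex]
  edge_empty k m i j s s' r he hk := by rw [← map_mul, h.edge_empty k m i j s s' r he hk, map_zero]
  edge_ne k m i j s s' r he hk hs := by rw [← map_mul, h.edge_ne k m i j s s' r he hk hs, map_zero]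

theorem relations_of_forall_map {l : G.EdgeLabeling} {B : Type*} [CStarAlgebra B]
    {q : G.Fiber → G.Fiber → B} {J : Type*} {C : J → Type*} [∀ j, CStarAlgebra (C j)]
    (φ : ∀ j, B →⋆ₐ[ℂ] C j) (hφ : ∀ x, (∀ j, φ j x = 0) → x = 0)
    (h : ∀ j, Relations l (C j) fun x y => φ j (q x y)) : Relations l B q := by
  have hinj : ∀ x y, (∀ j, φ j x = φ j y) → x = y := fun x y hxy =>
    sub_eq_zero.1 (hφ _ fun j => by rw [map_sub, hxy, sub_self])
  exact {
    isSelfAdjoint := fun x y => hinj _ _ fun j => by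
      rw [map_star, ((h j).isSelfAdjoint x y).star_eq]
    isIdempotentElem := fun x y => hinj _ _ fun j => by
      rw [map_mul, ((h j).isIdempotentElem x y).eq]
    sum_row := fun x => hinj _ _ fun j => by rw [map_sum, (h j).sum_row, map_one]
    sum_col := fun y => hinj _ _ fun j => by rw [map_sum, (h j).sum_col, map_one]
    vertex := fun k i s s' => hinj _ _ fun j => by
      rw [map_sum, map_sum, (h j).vertex k i s s']
    edge_empty := fun k m i i' s s' r he hk => hφ _ fun j => by
      rw [map_mul, (h j).edge_empty k m i i' s s' r he hk]
    edge_ne := fun k m i i' s s' r he hk hs => hφ _ fun j => by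
      rw [map_mul, (h j).edge_ne k m i i' s s' r he hk hs] }

/-- The identity permutation satisfies the relations. -/
theorem relations_one (l : G.EdgeLabeling) (B : Type*) [CStarAlgebra B] :
    Relations l B fun x y => if x = y then 1 else 0 where
  isSelfAdjoint x y := by split_ifs <;> simp
  isIdempotentElem x y := by split_ifs <;> simp [IsIdempotentElem]
  sum_row x := by simp
  sum_col y := by simp
  vertex k i s s' := by simp [Prod.mk.injEq, ite_and]
  edge_empty k m i j s s' r he hk := by
    by_cases h1 : (k, s) = (i, r)
    · by_cases h2 : (m, s') = (j, r)
      · simp only [Prod.mk.injEq] at h1 h2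
        have hne := he.nonempty
        rw [← h1.1, ← h2.1, hk] at hne
        exact absurd hne Finset.not_nonempty_empty
      · rw [if_neg h2, mul_zero]
    · rw [if_neg h1, zero_mul]
  edge_ne k m i j s s' r he hk hs := by
    by_cases h1 : (k, s) = (i, r)
    · by_cases h2 : (m, s') = (j, r)
      · simp only [Prod.mk.injEq] at h1 h2
        exact absurd (h1.2.trans h2.2.symm) hs
      · rw [if_neg h2, mul_zero]
    · rw [if_neg h1, zero_mul]

namespace Relations

variable {l : G.EdgeLabeling} {B : Type*} [CStarAlgebra B] {q : G.Fiber → G.Fiber → B}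

theorem mul_row (h : Relations l B q) (x : G.Fiber) {y z : G.Fiber} (hyz : y ≠ z) :
    q x y * q x z = 0 :=
  mul_eq_zero_of_sum_eq_one (h.isSelfAdjoint x) (h.isIdempotentElem x) (h.sum_row x) hyz

theorem mul_col (h : Relations l B q) (y : G.Fiber) {x z : G.Fiber} (hxz : x ≠ z) :
    q x y * q z y = 0 :=
  mul_eq_zero_of_sum_eq_one (p := fun x => q x y) (fun x => h.isSelfAdjoint x y)
    (fun x => h.isIdempotentElem x y) (h.sum_col y) hxz

end Relations

/-- The product of two coefficient entries vanishes unless both index pairs come from edges with the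
same label; here uniformity makes every label of a nonempty `E^k_m` occur. -/
theorem Relations.tmul_mul_tmul_eq_zero {l : G.EdgeLabeling} {B : Type u} [CStarAlgebra B]
    {q : G.Fiber → G.Fiber → B} (hG : G.IsUniform) (h : Relations l B q) {k m i j : V}
    {s s' r : Fin G.maxMult} (he : l.IsEdge i j r) (hks : G.edges k m = ∅ ∨ s ≠ s')
    (x y : G.Fiber) :
    MinTensor.tmul (q (k, s) x) (q x (i, r)) * MinTensor.tmul (q (m, s') y) (q y (j, r)) = 0 := by
  rw [MinTensor.tmul_mul_tmul]
  obtain ⟨k', t⟩ := x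
  obtain ⟨m', t'⟩ := y
  rcases (G.edges k' m').eq_empty_or_nonempty with h0 | h0
  · rw [h.edge_empty k' m' i j t t' r he h0, MinTensor.tmul_zero]
  by_cases ht : t = t'
  · subst ht
    have he' := l.isEdge_of_nonempty hG h0 t
    rcases (G.edges k m).eq_empty_or_nonempty with h1 | h1
    · rw [h.edge_empty k m k' m' s s' t he' h1, MinTensor.zero_tmul]
    · rw [h.edge_ne k m k' m' s s' t he' h1
        (hks.resolve_left h1.ne_empty), MinTensor.zero_tmul]
  · rw [h.edge_ne k' m' i j t t' r he h0 ht, MinTensor.tmul_zero]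

/-- The relations are stable under the matrix comultiplication. -/
theorem Relations.comul {l : G.EdgeLabeling} {B : Type u} [CStarAlgebra B]
    {q : G.Fiber → G.Fiber → B} (hG : G.IsUniform) (h : Relations l B q) :
    Relations l (MinTensor B B) fun x y => ∑ z, MinTensor.tmul (q x z) (q z y) where
  isSelfAdjoint x y := by
    rw [IsSelfAdjoint, star_sum]
    exact Finset.sum_congr rfl fun z _ => by
      rw [MinTensor.star_tmul, (h.isSelfAdjoint x z).star_eq, (h.isSelfAdjoint z y).star_eq]
  isIdempotentElem x y := by
    rw [IsIdempotentElem, Finset.sum_mul]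
    refine Finset.sum_congr rfl fun z _ => ?_
    rw [Finset.mul_sum, Finset.sum_eq_single z]
    · rw [MinTensor.tmul_mul_tmul, (h.isIdempotentElem x z).eq, (h.isIdempotentElem z y).eq]
    · intro w _ hw
      rw [MinTensor.tmul_mul_tmul, h.mul_row x hw.symm, MinTensor.zero_tmul]
    · simp
  sum_row x := by
    rw [Finset.sum_comm]
    simp only [← MinTensor.tmul_sum, h.sum_row, ← MinTensor.sum_tmul, MinTensor.one_tmul_one]
  sum_col y := by
    rw [Finset.sum_comm]
    simp only [← MinTensor.sum_tmul, h.sum_col, ← MinTensor.tmul_sum, MinTensor.one_tmul_one]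
  vertex k i s s' := by
    -- both sides are `∑ k', p k k' ⊗ p k' i` with `p k i = ∑ r, q (k, s) (i, r)`
    have hp : ∀ s, ∑ r, ∑ z, MinTensor.tmul (q (k, s) z) (q z (i, r)) =
        ∑ k', MinTensor.tmul (∑ t, q (k, s) (k', t)) (∑ r, q (k', s) (i, r)) := fun s => by
      rw [Finset.sum_comm, Fintype.sum_prod_type]
      refine Finset.sum_congr rfl fun k' _ => ?_
      rw [MinTensor.sum_tmul]
      exact Finset.sum_congr rfl fun t _ => by rw [← MinTensor.tmul_sum, h.vertex k' i t s]
    rw [hp, hp]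
    exact Finset.sum_congr rfl fun k' _ => by rw [h.vertex k k' s s', h.vertex k' i s s']
  edge_empty k m i j s s' r he hk := by
    rw [Finset.sum_mul_sum]
    exact Finset.sum_eq_zero fun x _ => Finset.sum_eq_zero fun y _ =>
      h.tmul_mul_tmul_eq_zero hG he (Or.inl hk) x y
  edge_ne k m i j s s' r he hk hs := by
    rw [Finset.sum_mul_sum]
    exact Finset.sum_eq_zero fun x _ => Finset.sum_eq_zero fun y _ =>
      h.tmul_mul_tmul_eq_zero hG he (Or.inr hs) x y

/-- The matrix of every object of the category satisfies the relations. -/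
theorem CoactionObj.relations (X : CoactionObj.{u} G) (l : G.EdgeLabeling) :
    Relations l X.qgroup.carrier (coactionMatrix X.qgroup X.coaction) where
  isSelfAdjoint := isSelfAdjoint_coactionMatrix _ _
  isIdempotentElem := isIdempotentElem_coactionMatrix _ _
  sum_row := sum_row_coactionMatrix _ _
  sum_col := X.isCoaction.sum_col_coactionMatrix
  vertex k i s s' := by
    have hsum : ∀ s, X.coaction (fun p => pointFunction i p.1) (k, s) =
        ∑ r, coactionMatrix X.qgroup X.coaction (k, s) (i, r) := fun s => by
      rw [coaction_apply, Fintype.sum_prod_type, Finset.sum_eq_single i]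
      · simp [pointFunction]
      · intro j _ hj; simp [pointFunction, hj]
      · simp
    rw [← hsum, ← hsum]
    exact apply_eq_of_mem_vertexTensor (X.map_vertex (pointFunction i)) k s s'
  edge_empty k m i j s s' r he hk := by
    rw [← adCoaction_single_apply]
    exact apply_eq_zero_of_mem_edgeSpaceTensor
      (X.map_edge _ (single_mem_edgeSpace ((l.isEdge_iff i j r).1 he))) (Or.inl hk)
  edge_ne k m i j s s' r he hk hs := by
    rw [← adCoaction_single_apply]
    exact apply_eq_zero_of_mem_edgeSpaceTensor
      (X.map_edge _ (single_mem_edgeSpace ((l.isEdge_iff i j r).1 he))) (Or.inr hs)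

/-! ### The universal object -/

namespace Relations

variable {l : G.EdgeLabeling} {A : Type u} [CStarAlgebra A] {q : G.Fiber → G.Fiber → A}

/-- The map `χ_y ↦ ∑ x, χ_x ⊗ q^x_y`. -/
noncomputable def coaction (h : Relations l A q) : (G.Fiber → ℂ) →⋆ₐ[ℂ] (G.Fiber → A) where
  toFun f x := ∑ y, f y • q x y
  map_one' := by ext x; simp [h.sum_row]
  map_mul' f g := by
    ext x
    rw [Pi.mul_apply, Finset.sum_mul]
    refine Finset.sum_congr rfl fun y _ => ?_
    rw [Finset.mul_sum, Finset.sum_eq_single y]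
    · rw [smul_mul_smul_comm, (h.isIdempotentElem x y).eq, Pi.mul_apply]
    · intro z _ hz
      rw [smul_mul_smul_comm, h.mul_row x hz.symm, smul_zero]
    · simp
  map_zero' := by ext x; simp
  map_add' f g := by ext x; simp [add_smul, Finset.sum_add_distrib]
  commutes' c := by
    ext x
    simp [Algebra.algebraMap_eq_smul_one, ← Finset.smul_sum, h.sum_row]
  map_star' f := by
    ext x
    simp [star_sum, (h.isSelfAdjoint x _).star_eq]

theorem coaction_apply (h : Relations l A q) (f : G.Fiber → ℂ) (x : G.Fiber) :
    h.coaction f x = ∑ y, f y • q x y := rfl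

theorem coaction_pointFunction (h : Relations l A q) (x y : G.Fiber) :
    h.coaction (pointFunction y) x = q x y := by
  rw [coaction_apply, Finset.sum_eq_single y]
  · simp [pointFunction]
  · intro z _ hz; simp [pointFunction, hz]
  · simp

end Relations

end Multigraph

open Multigraph

theorem mainTheorem1 {V : Type v} {E : Type w} [Fintype V] [DecidableEq V] [Fintype E]
    (G : Multigraph V E) (hG : G.IsUniform) (l : G.EdgeLabeling) :
    ∃ (Q : Multigraph.CoactionObj.{u} G) (q : G.Fiber → G.Fiber → Q.qgroup.carrier),
      Nonempty (CategoryTheory.Limits.IsInitial Q) ∧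
      IsUniversalCStarAlgebra
        (fun (B : Type u) [CStarAlgebra B] (b : G.Fiber × G.Fiber → B) =>
          Multigraph.Relations l B (fun x y => b (x, y)))
        Q.qgroup.carrier (fun p => q p.1 p.2) ∧
      (∀ x y, Q.qgroup.comul (q x y) = ∑ z, MinTensor.tmul (q x z) (q z y)) ∧
      (∀ y, Q.coaction (pointFunction y) = ∑ x, functionTensor (pointFunction x) (q x y)) := by
  obtain ⟨A, _, q', hq'⟩ := exists_isUniversalCStarAlgebra
    (fun (B : Type u) [CStarAlgebra B] (b : G.Fiber × G.Fiber → B) =>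
      Multigraph.Relations l B (fun x y => b (x, y)))
    (fun B _ b hb i => hb.isSelfAdjoint i.1 i.2)
    (fun B _ b hb i => norm_le_one_of_isIdempotentElem (hb.isSelfAdjoint i.1 i.2)
      (hb.isIdempotentElem i.1 i.2))
    (fun A _ a J B _ φ hφ h => relations_of_forall_map φ hφ h)
  obtain ⟨q, hqq'⟩ : ∃ q : G.Fiber → G.Fiber → A, q' = fun p => q p.1 p.2 :=
    ⟨fun x y => q' (x, y), rfl⟩
  subst hqq'
  have hrel : Relations l A q := hq'.rel_self
  have hgen := hq'.generates
  have hdense := dense_adjoin_of_topologicalClosure_eq_top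
    (fun p : G.Fiber × G.Fiber => hrel.isSelfAdjoint p.1 p.2) hgen
  have hnontrivial : Nontrivial A := by
    -- the identity permutation gives a homomorphism to `PUnit → ℂ`, a copy of `ℂ` in `Type u`
    obtain ⟨φ, -⟩ := (hq'.existsUnique_hom (PUnit.{u + 1} → ℂ)
      (fun p => if p.1 = p.2 then 1 else 0) (relations_one l _)).exists
    by_contra hA
    rw [not_nontrivial_iff_subsingleton] at hA
    have h : φ 1 = φ 0 := congrArg φ (Subsingleton.elim _ _)
    rw [map_one, map_zero] at h
    exact one_ne_zero h
  -- `A ⊗ A` lives one universe higher than the C*-algebras to which the universal property applies,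
  -- so the comultiplication is assembled from its components in pairs of representations.
  obtain ⟨Δ, hΔ'⟩ := MinTensor.exists_hom_of_eval hgen
    (fun p : G.Fiber × G.Fiber => ∑ z, MinTensor.tmul (q p.1 z) (q z p.2))
    fun π ρ => (hq'.existsUnique_hom _ _ ((hrel.comul hG).map (MinTensor.eval π ρ))).exists
  have hΔ : ∀ x y, Δ (q x y) = ∑ z, MinTensor.tmul (q x z) (q z y) := fun x y => hΔ' (x, y)
  let S : CompactQuantumGroup.{u} :=
    { carrier := A
      comul := Δ
      coassoc := isCoassociative_of_comul hdense hΔ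
      dense_right := dense_comul_mul_right hdense hΔ hrel.sum_row hrel.isIdempotentElem
        fun y _ _ hxz => hrel.mul_col y hxz
      dense_left := dense_comul_mul_left hdense hΔ hrel.sum_col hrel.isIdempotentElem
        fun x _ _ hyz => hrel.mul_row x hyz }
  have hmatrix : ∀ x y, coactionMatrix S hrel.coaction x y = q x y :=
    hrel.coaction_pointFunction
  let Q : CoactionObj.{u} G :=
    { qgroup := S
      coaction := hrel.coaction
      isCoaction :=
        { coassoc := fun f => by
            ext1 x
            change ∑ y, MinTensor.tmul (hrel.coaction (pointFunction y) x) (hrel.coaction f y) =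
              Δ (hrel.coaction f x)
            simp only [hrel.coaction_pointFunction, hrel.coaction_apply, map_sum, map_smul, hΔ,
              MinTensor.tmul_sum, MinTensor.tmul_smul, Finset.smul_sum]
            exact Finset.sum_comm
          dense := fun F => by
            refine subset_closure ?_
            -- `χ_x ⊗ a = ∑ y, α(χ_y)(1 ⊗ q_xy a)`
            have hF : F = ∑ x, ∑ y, hrel.coaction (pointFunction y) *
                functionTensor 1 (q x y * F x) := by
              ext w
              simp only [Finset.sum_apply, Pi.mul_apply, hrel.coaction_pointFunction,
                functionTensor, Pi.one_apply, one_smul, ← mul_assoc, ← Finset.sum_mul]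
              rw [Finset.sum_eq_single w]
              · simp only [(hrel.isIdempotentElem w _).eq]
                rw [hrel.sum_row, one_mul]
              · intro x _ hx
                rw [Finset.sum_eq_zero fun y _ => hrel.mul_col y hx.symm, zero_mul]
              · simp
            rw [hF]
            exact Submodule.sum_mem _ fun x _ => Submodule.sum_mem _ fun y _ =>
              Submodule.subset_span ⟨_, _, rfl⟩ }
      map_vertex := fun f => mem_vertexTensor fun k s t => by
        simp only [hrel.coaction_apply, Fintype.sum_prod_type, ← Finset.smul_sum]
        exact Finset.sum_congr rfl fun i _ => by rw [hrel.vertex k i s t]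
      map_edge := fun T hT => by
        induction hT using Submodule.span_induction with
        | mem T hT =>
          obtain ⟨i, j, r, -, hr, rfl⟩ := hT
          have he := (l.isEdge_iff i j r).2 hr
          refine mem_edgeSpaceTensor hG fun k m s t h => ?_
          rw [adCoaction_single_apply, hmatrix, hmatrix]
          rcases (G.edges k m).eq_empty_or_nonempty with h0 | h0
          · exact hrel.edge_empty k m i j s t r he h0
          · exact hrel.edge_ne k m i j s t r he h0 (h.resolve_left h0.ne_empty)
        | zero =>
          rw [adCoaction, Matrix.map_zero _ (map_zero _), mul_zero, zero_mul]
          exact Submodule.zero_mem _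
        | add T T' _ _ h h' =>
          rw [adCoaction, Matrix.map_add _ (map_add _), mul_add, add_mul]
          exact Submodule.add_mem _ h h'
        | smul c T _ h =>
          have : adCoaction S hrel.coaction (c • T) = c • adCoaction S hrel.coaction T := by
            rw [adCoaction, adCoaction, show (c • T).map (algebraMap ℂ S.carrier) =
              c • T.map (algebraMap ℂ S.carrier) by
                ext x y
                rw [Matrix.map_apply, Matrix.smul_apply, Matrix.smul_apply, Matrix.map_apply,
                  smul_eq_mul, map_mul, Algebra.smul_def], mul_smul_comm, smul_mul_assoc]
          rw [this]
          exact Submodule.smul_mem _ c h }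
  refine ⟨Q, q, ⟨?_⟩, hq', hΔ, fun y => ?_⟩
  · have huniq : ∀ X : CoactionObj.{u} G, ∃! φ : A →⋆ₐ[ℂ] X.qgroup.carrier,
        ∀ p : G.Fiber × G.Fiber, φ (q p.1 p.2) = coactionMatrix X.qgroup X.coaction p.1 p.2 :=
      fun X => hq'.existsUnique_hom _ _ (X.relations l)
    choose φ hφ hφ' using huniq
    have hhom : ∀ X, IsQuantumGroupHom S X.qgroup (φ X) := fun X a => by
      have h : (MinTensor.map (φ X) (φ X)).comp Δ = X.qgroup.comul.comp (φ X) := by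
        refine StarAlgHom.ext_of_topologicalClosure_adjoin_eq_top hgen fun p => ?_
        rw [StarAlgHom.comp_apply, StarAlgHom.comp_apply, hΔ, map_sum, hφ X p,
          X.isCoaction.comul_coactionMatrix]
        exact Finset.sum_congr rfl fun z _ => by
          rw [MinTensor.map_tmul, hφ X (p.1, z), hφ X (z, p.2)]
      exact congrArg (fun f => f a) h
    refine CategoryTheory.Limits.IsInitial.ofUniqueHom (fun X => (⟨φ X, hhom X, fun f x => ?_⟩ :
      CoactionObj.Hom Q X)) fun X m => CoactionObj.Hom.ext (hφ' X _ fun p => ?_)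
    · change φ X (∑ y, f y • q x y) = _
      rw [map_sum, coaction_apply X.qgroup X.coaction f x]
      exact Finset.sum_congr rfl fun y _ => by rw [map_smul, hφ X (x, y)]
    · have h := CoactionObj.Hom.intertwines m (pointFunction p.2) p.1
      rw [show Q.coaction (pointFunction p.2) p.1 = q p.1 p.2 from
        hrel.coaction_pointFunction p.1 p.2] at h
      exact h
  · ext x
    rw [Finset.sum_apply, Finset.sum_eq_single x]
    · rw [show Q.coaction (pointFunction y) x = q x y from hrel.coaction_pointFunction x y]
      simp [functionTensor, pointFunction]
    · intro z _ hz
      simp [functionTensor, pointFunction, hz.symm]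
    · simp
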